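/- All graphs are finite and simple, and are considered up to isomorphism. Let $G$ be a graph and let $f\colon E(G)\to E(G)$ be a mapping with $f(e)\neq e$ for all $e\in E(G)$. A subgraph $H$ of $G$ is called $f$-free if $f(e)\notin E(H)$ for all $e\in E(H)$. A graph $G$ is unavoidable for a graph $F$ if $G$ contains a subgraph isomorphic to $F$ and, for every mapping $f\colon E(G)\to E(G)$ with $f(e)\ne e$ for all $e\in E(G)$, some subgraph of $G$ isomorphic to $F$ is $f$-free. It is minimal unavoidable for $F$ if moreover no proper subgraph of $G$ is unavoidable for $F$. Let $\mathcal{M}(F)$ denote the set of (isomorphism classes of) minimal unavoidable graphs for $F$, and for $t\ge 0$ let $tK_2$ be the vertex-disjoint union of $t$ copies of $K_2$. Theorem. If $F$ is a forest without isolated vertices, then $\mathcal{M}(F)$ is finite if and only if $F\cong tK_2$ for some $t\ge 0$. More generally, for every forest $F$, $\mathcal{M}(F)$ is finite if and only if the graph obtained from $F$ by deleting its isolated vertices is isomorphic to $tK_2$ for some $t\ge 0$. -/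

import Mathlib

namespace EdgeMapping

open SimpleGraph

/-- A subgraph `H` of `G` is `f`-free, for an edge mapping `f : E(G) → E(G)`, if `f e ∉ E(H)` for
every edge `e ∈ E(H)`. -/
def IsFree {V : Type*} {G : SimpleGraph V} (f : G.edgeSet → G.edgeSet) (H : G.Subgraph) : Prop :=
  ∀ e : G.edgeSet, (e : Sym2 V) ∈ H.edgeSet → (f e : Sym2 V) ∉ H.edgeSet

/-- `G` is unavoidable for `F` if `G` contains a copy of `F` and, for every edge mapping
`f : E(G) → E(G)` with `f e ≠ e` for all `e` (equivalently `|f e ∩ e| ≤ 1`), there is an `f`-free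
copy of `F` in `G`.

The first clause follows from the second as soon as a mapping without fixed edges exists, that is,
whenever `G` does not have exactly one edge. It only prevents a graph with a single edge (which has
no such mapping) from being vacuously unavoidable for every graph. -/
def Unavoidable {V W : Type*} (G : SimpleGraph V) (F : SimpleGraph W) : Prop :=
  F.IsContained G ∧
    ∀ f : G.edgeSet → G.edgeSet, (∀ e, f e ≠ e) →
      ∃ H : G.Subgraph, Nonempty (F ≃g H.coe) ∧ IsFree f H

/-- `G` is minimal unavoidable for `F`: it is unavoidable for `F`, and no proper subgraph (obtained
by deleting edges and/or vertices) is unavoidable for `F`. -/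
def MinimalUnavoidable {V W : Type*} (G : SimpleGraph V) (F : SimpleGraph W) : Prop :=
  Unavoidable G F ∧ ∀ H : G.Subgraph, H ≠ ⊤ → ¬ Unavoidable H.coe F

/-- Isomorphism of finite graphs; every finite graph is isomorphic to one on some `Fin n`. -/
instance finiteGraphSetoid : Setoid (Σ n : ℕ, SimpleGraph (Fin n)) where
  r G H := Nonempty (G.2 ≃g H.2)
  iseqv :=
    { refl := fun _ => ⟨Iso.refl⟩
      symm := fun ⟨e⟩ => ⟨e.symm⟩
      trans := fun ⟨e⟩ ⟨e'⟩ => ⟨e.trans e'⟩ }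

/-- Isomorphism classes of finite graphs. -/
abbrev FiniteGraphClass : Type := Quotient finiteGraphSetoid

/-- The set `𝓜(F)` of (isomorphism classes of) finite minimal unavoidable graphs for `F`. -/
def minimalUnavoidableGraphs {W : Type*} (F : SimpleGraph W) : Set FiniteGraphClass :=
  {c | ∃ G : Σ n : ℕ, SimpleGraph (Fin n), ⟦G⟧ = c ∧ MinimalUnavoidable G.2 F}

/-- The matching `t K₂`: the vertex-disjoint union of `t` copies of `K₂`. -/
def matchingGraph (t : ℕ) : SimpleGraph (Fin t × Fin 2) where
  Adj x y := x.1 = y.1 ∧ x.2 ≠ y.2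
  symm := ⟨fun _ _ h => ⟨h.1.symm, h.2.symm⟩⟩
  loopless := ⟨fun _ h => h.2 rfl⟩

end EdgeMapping

/-!
A mapping `g` on the edges of `G` assigns out-degree one to every edge, so among many candidate
edges one third can be chosen that are pairwise unrelated by `g`; candidate copies of a graph with
`q` edges lose a factor `2 * q + 1` in the same way.

Suppose that the edges of `F` form `t K₂`. Then `3t K₂` is unavoidable for `F`, up to isolated
vertices. Hence a minimal unavoidable graph that contains `3t K₂` has boundedly many vertices, and
any other one has a vertex cover of bounded size. A graph with vertex cover `C` is determined by
the subgraph induced on `C` and by the number of vertices outside `C` with a given neighbourhood in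
`C`, so by Dickson's lemma infinitely many such graphs cannot be pairwise incomparable.

In all other cases there are, for every `N`, unavoidable graphs none of whose subgraphs with at most
`N` vertices is unavoidable. If some component of `F` is not a star, then no forest is unavoidable
for `F`: orient its edges towards roots and map each edge to the next one. A graph with sufficiently
many edges per vertex is unavoidable, and can be chosen such that its small subgraphs are forests.

If `F` is a forest of stars with maximum degree `s + 2 ≥ 2`, take disjoint copies of a long cycle
with `3 * s` pendant edges at every vertex and one more pendant edge. Because of that single
additional edge, counting the pairs `(e, g e)` inside the stars at the vertices of the cycle shows
that some of these stars contains `s + 2` pairwise unrelated edges. A small subgraph misses a vertex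
of every cycle; once a cycle is cut there, its edges and the additional one can be shifted along it
such that any two of them at a common vertex are related. Rotating each of the `s` triples of
pendant edges at a vertex leaves at most `s + 1` unrelated edges in every star.
-/

namespace EdgeMapping

open SimpleGraph
open scoped Finset

/-! ### Unavoidability -/

theorem Unavoidable.exists_free_copy {V W : Type*} {G : SimpleGraph V} {F : SimpleGraph W}
    (h : Unavoidable G F) (g : Sym2 V → Sym2 V) :
    ∃ φ : Copy F G, (Sym2.map φ '' F.edgeSet).Pairwise fun e e' => g e ≠ e' := by
  classical
  obtain ⟨⟨φ₀⟩, hfree⟩ := h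
  by_cases hF : F.edgeSet.Subsingleton
  · exact ⟨φ₀, (hF.image _).pairwise _⟩
  have : Nontrivial F.edgeSet := (Set.not_subsingleton_iff.1 hF).coe_sort
  have : Nontrivial G.edgeSet := φ₀.mapEdgeSet.injective.nontrivial
  choose other hother using fun e : G.edgeSet => exists_ne e
  let f : G.edgeSet → G.edgeSet := fun e =>
    if hg : g e ∈ G.edgeSet ∧ g e ≠ e then ⟨g e, hg.1⟩ else other e
  have hf : ∀ e, f e ≠ e := fun e => by
    by_cases hg : g e ∈ G.edgeSet ∧ g e ≠ e
    · simp only [f, dif_pos hg]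
      exact fun h => hg.2 (congrArg Subtype.val h)
    · simp only [f, dif_neg hg]
      exact hother e
  obtain ⟨H, ⟨i⟩, hH⟩ := hfree f hf
  let φ : Copy F G := H.coeCopy.comp i.toCopy
  have hφ : Sym2.map φ '' F.edgeSet ⊆ H.edgeSet := by
    rintro _ ⟨⟨u, v⟩, huv, rfl⟩
    exact i.map_adj_iff.2 huv
  refine ⟨φ, fun e he e' he' hne hge => ?_⟩
  have hg : g e ∈ G.edgeSet ∧ g e ≠ e := hge ▸ ⟨H.edgeSet_subset (hφ he'), hne.symm⟩
  refine hH ⟨e, H.edgeSet_subset (hφ he)⟩ (hφ he) ?_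
  simpa only [f, dif_pos hg, hge] using hφ he'

theorem image_edgeSet_subset {V W : Type*} {G : SimpleGraph V} {F : SimpleGraph W} (φ : Copy F G) :
    Sym2.map φ '' F.edgeSet ⊆ G.edgeSet := by
  rintro _ ⟨⟨u, v⟩, huv, rfl⟩
  exact φ.toHom.map_adj huv

theorem edgeSet_toSubgraph {V W : Type*} {G : SimpleGraph V} {F : SimpleGraph W} (φ : Copy F G) :
    φ.toSubgraph.edgeSet = Sym2.map φ '' F.edgeSet := by
  simp [Copy.toSubgraph, Subgraph.edgeSet_map]

/-- A fixed pair of `g` imposes no condition here, and neither does a pair mapped outside `G`. -/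
theorem unavoidable_iff {V W : Type*} {G : SimpleGraph V} {F : SimpleGraph W} :
    Unavoidable G F ↔ ∀ g : Sym2 V → Sym2 V, ∃ φ : Copy F G,
      (Sym2.map φ '' F.edgeSet).Pairwise fun e e' => g e ≠ e' := by
  classical
  refine ⟨fun h => h.exists_free_copy, fun h => ⟨⟨(h id).choose⟩, fun f hf => ?_⟩⟩
  obtain ⟨φ, hφ⟩ := h fun e => if he : e ∈ G.edgeSet then (f ⟨e, he⟩ : Sym2 V) else e
  refine ⟨φ.toSubgraph, ⟨φ.isoToSubgraph⟩, fun e he hfe => ?_⟩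
  rw [edgeSet_toSubgraph] at he hfe
  refine hφ he hfe (fun heq => hf e (Subtype.ext heq.symm)) ?_
  rw [dif_pos e.2]

theorem Unavoidable.exists_free_copy_comp {U V W : Type*} {K : SimpleGraph U} {G : SimpleGraph V}
    {F : SimpleGraph W} (h : Unavoidable K F) (ψ : Copy K G) (g : Sym2 V → Sym2 V) :
    ∃ φ : Copy F K, (Sym2.map (ψ.comp φ) '' F.edgeSet).Pairwise fun e e' => g e ≠ e' := by
  classical
  have hψ : Function.Injective (Sym2.map ψ) := Sym2.map.injective ψ.injective
  obtain ⟨φ, hφ⟩ := h.exists_free_copy fun e =>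
    Function.extend (Sym2.map ψ) id (fun _ => e) (g (e.map ψ))
  refine ⟨φ, ?_⟩
  rw [Copy.coe_comp, Sym2.map_comp, Set.image_comp, hψ.injOn.pairwise_image]
  refine hφ.mono' fun e e' hne heq => hne ?_
  rw [show g (e.map ψ) = e'.map ψ from heq, hψ.extend_apply, id]

theorem Unavoidable.mono {U V W : Type*} {K : SimpleGraph U} {G : SimpleGraph V}
    {F : SimpleGraph W} (h : Unavoidable K F) (hKG : K ⊑ G) : Unavoidable G F := by
  obtain ⟨ψ⟩ := hKG
  refine unavoidable_iff.2 fun g => ?_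
  obtain ⟨φ, hφ⟩ := h.exists_free_copy_comp ψ g
  exact ⟨ψ.comp φ, hφ⟩

theorem Unavoidable.anti_right {V W W' : Type*} {G : SimpleGraph V} {F : SimpleGraph W}
    {F' : SimpleGraph W'} (h : Unavoidable G F) (hF : F' ⊑ F) : Unavoidable G F' := by
  obtain ⟨ψ⟩ := hF
  refine unavoidable_iff.2 fun g => ?_
  obtain ⟨φ, hφ⟩ := h.exists_free_copy g
  refine ⟨φ.comp ψ, hφ.mono ?_⟩
  rw [Copy.coe_comp, Sym2.map_comp, Set.image_comp]
  exact Set.image_mono (image_edgeSet_subset ψ)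

theorem MinimalUnavoidable.of_iso {U V W : Type*} {K : SimpleGraph U} {G : SimpleGraph V}
    {F : SimpleGraph W} (h : MinimalUnavoidable K F) (i : K ≃g G) : MinimalUnavoidable G F := by
  refine ⟨h.1.mono i.isContained, fun H hH hF => ?_⟩
  refine h.2 (H.map i.symm.toHom) (fun htop => hH ?_)
    (hF.mono (i.symm.toCopy.isoSubgraphMap H).isContained)
  have hcomap : (H.map i.symm.toHom).map i.toHom = H := by
    rw [← Subgraph.map_comp]
    convert H.map_id
    ext v
    exact i.apply_symm_apply v
  rw [← hcomap, htop]
  exact Subgraph.map_iso_top i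

theorem Unavoidable.exists_minimal {V W : Type*} [Finite V] {G : SimpleGraph V}
    {F : SimpleGraph W} (h : Unavoidable G F) :
    ∃ (n : ℕ) (K : SimpleGraph (Fin n)), K ⊑ G ∧ MinimalUnavoidable K F := by
  have htop : Unavoidable (⊤ : G.Subgraph).coe F := h.mono Subgraph.topIso.isContained'
  obtain ⟨H, hH⟩ := (Set.toFinite {H : G.Subgraph | Unavoidable H.coe F}).exists_minimal ⟨⊤, htop⟩
  have hmin : MinimalUnavoidable H.coe F := by
    refine ⟨hH.prop, fun H' hne hU => hne (Subgraph.coeSubgraph_injective H ?_)⟩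
    have hle : Subgraph.coeSubgraph H' ≤ H := Subgraph.coeSubgraph_le H'
    have hge := hH.le_of_le (y := Subgraph.coeSubgraph H')
      (hU.mono (H.coeCopy.isoSubgraphMap H').isContained) hle
    rw [le_antisymm hle hge]
    simp [Subgraph.coeSubgraph, Subgraph.map_hom_top]
  obtain ⟨n, ⟨e⟩⟩ := Finite.exists_equiv_fin H.verts
  exact ⟨n, H.coe.map e.toEmbedding, (Iso.map e H.coe).isContained'.trans H.coe_isContained,
    hmin.of_iso (Iso.map e H.coe)⟩

theorem MinimalUnavoidable.nonempty_iso {U V W : Type*} {K : SimpleGraph U} {G : SimpleGraph V}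
    {F : SimpleGraph W} (hG : MinimalUnavoidable G F) (hK : Unavoidable K F) (hKG : K ⊑ G) :
    Nonempty (K ≃g G) := by
  obtain ⟨φ⟩ := hKG
  have htop : φ.toSubgraph = ⊤ :=
    not_not.1 fun hne => hG.2 _ hne (hK.mono φ.isoToSubgraph.isContained)
  exact ⟨(htop ▸ φ.isoToSubgraph).trans Subgraph.topIso⟩

theorem infinite_minimalUnavoidableGraphs {W : Type*} {F : SimpleGraph W}
    (h : ∀ N : ℕ, ∃ (V : Type) (_ : Finite V) (G : SimpleGraph V), Unavoidable G F ∧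
      ∀ n ≤ N, ∀ K : SimpleGraph (Fin n), K ⊑ G → ¬ Unavoidable K F) :
    (minimalUnavoidableGraphs F).Infinite := by
  intro hfin
  let size : FiniteGraphClass → ℕ := Quotient.lift (fun G => G.1) fun G H ⟨e⟩ => by
    simpa using Fintype.card_congr e.toEquiv
  obtain ⟨N, hN⟩ := (hfin.image size).bddAbove
  obtain ⟨V, _, G, hG, hsmall⟩ := h N
  obtain ⟨n, K, hK, hmin⟩ := hG.exists_minimal
  exact hsmall n (hN ⟨⟦⟨n, K⟩⟧, ⟨⟨n, K⟩, rfl, hmin⟩, rfl⟩) K hK hmin.1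

/-! ### Independent sets of a self-map -/

theorem exists_pairwise_not_rel_of_outDegree_le {α : Type*} (R : α → α → Prop) [DecidableRel R]
    {r m : ℕ} {A : Finset α} (hR : ∀ x ∈ A, #{y ∈ A | R x y} ≤ r)
    (hm : (2 * r + 1) * m ≤ #A) :
    ∃ B ⊆ A, #B = m ∧ (B : Set α).Pairwise fun x y => ¬ R x y := by
  classical
  induction m generalizing A with
  | zero => exact ⟨∅, by simp⟩
  | succ m ih =>
    obtain ⟨x, hx, hin⟩ : ∃ x ∈ A, #{y ∈ A | R y x} ≤ r := by
      refine Finset.exists_le_of_sum_le (Finset.card_pos.1 (by nlinarith)) ?_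
      exact (Finset.sum_card_bipartiteAbove_eq_sum_card_bipartiteBelow R).ge.trans
        (Finset.sum_le_sum hR)
    let Q : Finset α := insert x ({y ∈ A | R x y} ∪ {y ∈ A | R y x})
    have hQ : #Q ≤ 2 * r + 1 := by
      refine (Finset.card_insert_le _ _).trans ?_
      have := Finset.card_union_le {y ∈ A | R x y} {y ∈ A | R y x}
      have := hR x hx
      omega
    have hAQ := Finset.le_card_sdiff Q A
    obtain ⟨B, hBA, hBm, hB⟩ := ih (A := A \ Q)
      (fun z hz => (Finset.card_le_card (Finset.filter_subset_filter _ Finset.sdiff_subset)).trans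
        (hR z (Finset.sdiff_subset hz)))
      (by rw [mul_add_one] at hm; omega)
    have hBQ : ∀ z ∈ B, z ∈ A ∧ z ≠ x ∧ ¬ R x z ∧ ¬ R z x := fun z hz => by
      have := hBA hz
      simp only [Q, Finset.mem_sdiff, Finset.mem_insert, Finset.mem_union,
        Finset.mem_filter] at this
      tauto
    refine ⟨insert x B, Finset.insert_subset hx fun z hz => (hBQ z hz).1, ?_, ?_⟩
    · rw [Finset.card_insert_of_notMem fun h => (hBQ x h).2.1 rfl, hBm]
    · rw [Finset.coe_insert, Set.pairwise_insert]
      exact ⟨hB, fun z hz _ => (hBQ z hz).2.2⟩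

theorem exists_pairwise_apply_ne {α : Type*} (g : α → α) {m : ℕ} {A : Finset α}
    (hm : 3 * m ≤ #A) : ∃ B ⊆ A, #B = m ∧ (B : Set α).Pairwise fun x y => g x ≠ y := by
  classical
  exact exists_pairwise_not_rel_of_outDegree_le (fun x y => g x = y)
    (fun _ _ => Finset.card_le_one.2 fun _ hy _ hz =>
      (Finset.mem_filter.1 hy).2.symm.trans (Finset.mem_filter.1 hz).2) hm

/-- The tails of the arcs `x ↦ g x`, loops excluded, that stay inside `A`. They measure how far `A`
is from being independent for `g`. -/
def internalArcs {α : Type*} [DecidableEq α] (g : α → α) (A : Finset α) : Finset α :=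
  {x ∈ A | g x ∈ A ∧ g x ≠ x}

theorem internalArcs_eq_self {α : Type*} [DecidableEq α] {g : α → α} {A : Finset α}
    (hmaps : Set.MapsTo g A A) (hfix : ∀ x ∈ A, g x ≠ x) : internalArcs g A = A :=
  Finset.filter_true_of_mem fun x hx => ⟨hmaps hx, hfix x hx⟩

theorem injOn_of_forall_exists_ne_apply_eq {α : Type*} {g : α → α} {A : Finset α}
    (hA : ∀ x ∈ A, ∃ y ∈ A, y ≠ x ∧ g y = x) :
    Set.MapsTo g A A ∧ Set.InjOn g A ∧ ∀ x ∈ A, g x ≠ x := by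
  classical
  have himage : A.image g = A := by
    refine (Finset.eq_of_subset_of_card_le (fun x hx => ?_) Finset.card_image_le).symm
    obtain ⟨y, hy, -, hyx⟩ := hA x hx
    exact Finset.mem_image.2 ⟨y, hy, hyx⟩
  have hinj : Set.InjOn g A := Finset.card_image_iff.1 (by rw [himage])
  refine ⟨fun x hx => himage ▸ Finset.mem_image_of_mem g hx, hinj, fun x hx h => ?_⟩
  obtain ⟨y, hy, hyx, hgy⟩ := hA x hx
  exact hyx (hinj hy hx (hgy.trans h.symm))

/-- If every vertex of `A` is the image of another one, then `g` permutes `A` without fixed points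
and every arc is internal; otherwise let `x` be a vertex that is not such an image. -/
theorem exists_greedy_block {α : Type*} [DecidableEq α] (g : α → α) {A : Finset α}
    (hA : A.Nonempty) :
    ∃ x ∈ A, ∃ R ⊆ A, x ∈ R ∧ (∀ y ∈ A \ R, g x ≠ y ∧ g y ≠ x) ∧
      2 * #R ≤ 3 + #(internalArcs g A ∩ R) := by
  by_cases hsource : ∃ x ∈ A, ∀ y ∈ A, y ≠ x → g y ≠ x
  · obtain ⟨x, hx, hin⟩ := hsource
    by_cases hout : x ∈ internalArcs g A
    · have hgx := (Finset.mem_filter.1 hout).2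
      refine ⟨x, hx, {x, g x}, by simp [Finset.insert_subset_iff, hx, hgx.1], by simp, ?_, ?_⟩
      · simp +contextual [hin, eq_comm]
      · have : 0 < #(internalArcs g A ∩ {x, g x}) :=
          Finset.card_pos.2 ⟨x, by simp [hout]⟩
        have := Finset.card_le_two (a := x) (b := g x)
        omega
    · refine ⟨x, hx, {x}, by simpa, by simp, ?_,
        by simp only [Finset.card_singleton, mul_one]; omega⟩
      simp +contextual only [Finset.mem_sdiff, Finset.mem_singleton, and_imp]
      refine fun y hy hyx => ⟨fun h => hout ?_, hin y hy hyx⟩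
      simp [internalArcs, hx, h, hy, hyx]
  · push Not at hsource
    obtain ⟨hmaps, hinj, hfix⟩ := injOn_of_forall_exists_ne_apply_eq hsource
    obtain ⟨x, hx⟩ := hA
    obtain ⟨y, hy, -, hyx⟩ := hsource x hx
    have hR : {x, g x, y} ⊆ A := by
      simpa [Finset.insert_subset_iff, hx, hy] using hmaps hx
    refine ⟨x, hx, {x, g x, y}, hR, by simp, fun z hz => ?_, ?_⟩
    · simp only [Finset.mem_sdiff, Finset.mem_insert, Finset.mem_singleton, not_or] at hz
      exact ⟨Ne.symm hz.2.2.1, fun h => hz.2.2.2 (hinj hz.1 hy (h.trans hyx.symm))⟩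
    · rw [internalArcs_eq_self hmaps hfix, Finset.inter_eq_right.2 hR]
      have := Finset.card_le_three (a := x) (b := g x) (c := y)
      omega

theorem exists_pairwise_apply_ne_of_internalArcs {α : Type*} [DecidableEq α] (g : α → α)
    (A : Finset α) :
    ∃ B ⊆ A, (B : Set α).Pairwise (fun x y => g x ≠ y) ∧ 2 * #A ≤ 3 * #B + #(internalArcs g A) := by
  induction A using Finset.strongInduction with
  | H A ih =>
  rcases A.eq_empty_or_nonempty with rfl | hA
  · exact ⟨∅, by simp⟩
  obtain ⟨x, hx, R, hRA, hxR, hxB, hR⟩ := exists_greedy_block g hA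
  obtain ⟨B, hBA, hB, hcard⟩ := ih (A \ R) (Finset.sdiff_ssubset hRA ⟨x, hxR⟩)
  have harcs : #(internalArcs g (A \ R)) + #(internalArcs g A ∩ R) ≤ #(internalArcs g A) := by
    rw [← Finset.card_sdiff_add_card_inter (internalArcs g A) R]
    gcongr
    intro y hy
    simp only [internalArcs, Finset.mem_filter, Finset.mem_sdiff] at hy ⊢
    tauto
  refine ⟨insert x B, Finset.insert_subset hx (hBA.trans Finset.sdiff_subset), ?_, ?_⟩
  · rw [Finset.coe_insert, Set.pairwise_insert]
    exact ⟨hB, fun y hy _ => hxB y (hBA hy)⟩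
  · rw [Finset.card_insert_of_notMem fun h => (Finset.mem_sdiff.1 (hBA h)).2 hxR]
    have := Finset.card_sdiff_add_card_eq_card hRA
    omega

/-! ### Disjoint copies -/

/-- The vertex-disjoint union of copies of `G` indexed by `ι`. -/
def disjointCopies {V : Type*} (ι : Type*) (G : SimpleGraph V) : SimpleGraph (ι × V) where
  Adj x y := x.1 = y.1 ∧ G.Adj x.2 y.2
  symm := ⟨fun _ _ h => ⟨h.1.symm, h.2.symm⟩⟩
  loopless := ⟨fun _ h => h.2.ne rfl⟩

theorem matchingGraph_eq_disjointCopies (t : ℕ) : matchingGraph t = disjointCopies (Fin t) ⊤ := rfl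

/-- The index of the copy that contains a pair of vertices of a disjoint union; for a pair that
meets two copies this is the index of one of them. -/
noncomputable def copyIndex {ι V : Type*} (e : Sym2 (ι × V)) : ι :=
  e.out.1.1

theorem copyIndex_map_mk {ι V : Type*} (c : ι) (e : Sym2 V) :
    copyIndex (e.map (Prod.mk c)) = c := by
  obtain ⟨v, -, hv⟩ := Sym2.mem_map.1 (Sym2.out_fst_mem (e.map (Prod.mk c)))
  exact congrArg Prod.fst hv.symm

/-- The copy of `G` with index `c` in `disjointCopies ι G`. -/
def copyAt {ι V : Type*} (G : SimpleGraph V) (c : ι) : Copy G (disjointCopies ι G) where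
  toHom := ⟨Prod.mk c, fun h => ⟨rfl, h⟩⟩
  injective' := Prod.mk_right_injective c

@[simp]
theorem coe_copyAt {ι V : Type*} (G : SimpleGraph V) (c : ι) : ⇑(copyAt G c) = Prod.mk c := rfl

/-- Copies of `F`, one in each of the copies of `G` selected by `κ`. -/
def assembleCopies {ι κ V W : Type*} {F : SimpleGraph W} {G : SimpleGraph V} (φ : ι → Copy F G)
    (f : κ ↪ ι) : Copy (disjointCopies κ F) (disjointCopies ι G) where
  toHom :=
    { toFun := fun x => (f x.1, φ (f x.1) x.2)
      map_rel' := by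
        rintro ⟨a, u⟩ ⟨_, v⟩ ⟨rfl, huv⟩
        exact ⟨rfl, (φ (f a)).toHom.map_adj huv⟩ }
  injective' := by
    rintro ⟨a, u⟩ ⟨b, v⟩ h
    obtain rfl : a = b := f.injective (congrArg Prod.fst h)
    exact congrArg (Prod.mk a) ((φ (f a)).injective (congrArg Prod.snd h))

theorem image_assembleCopies {ι κ V W : Type*} {F : SimpleGraph W} {G : SimpleGraph V}
    (φ : ι → Copy F G) (f : κ ↪ ι) :
    Sym2.map (assembleCopies φ f) '' (disjointCopies κ F).edgeSet =
      ⋃ a, Sym2.map ((copyAt G (f a)).comp (φ (f a))) '' F.edgeSet := by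
  ext e
  simp only [Set.mem_image, Set.mem_iUnion]
  constructor
  · rintro ⟨⟨⟨a, u⟩, ⟨b, v⟩⟩, ⟨hab, huv⟩, rfl⟩
    obtain rfl : a = b := hab
    exact ⟨a, s(u, v), huv, rfl⟩
  · rintro ⟨a, ⟨u, v⟩, huv, rfl⟩
    exact ⟨s((a, u), (a, v)), ⟨rfl, huv⟩, rfl⟩

theorem Unavoidable.disjointCopies {ι V W : Type*} [Fintype ι] [Finite W] {G : SimpleGraph V}
    {F : SimpleGraph W} (h : Unavoidable G F) {m : ℕ}
    (hm : (2 * F.edgeSet.ncard + 1) * m ≤ Fintype.card ι) :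
    Unavoidable (disjointCopies ι G) (disjointCopies (Fin m) F) := by
  classical
  refine unavoidable_iff.2 fun g => ?_
  choose φ hφ using fun c : ι => h.exists_free_copy_comp (copyAt G c) g
  let E : ι → Set (Sym2 (ι × V)) := fun c => Sym2.map ((copyAt G c).comp (φ c)) '' F.edgeSet
  have hE : ∀ c, ∀ e ∈ E c, copyIndex e = c := by
    rintro c _ ⟨e, -, rfl⟩
    rw [Copy.coe_comp, coe_copyAt, Sym2.map_comp]
    exact copyIndex_map_mk c _
  have hdeg : ∀ c, #{c' | ∃ e ∈ E c, g e ∈ E c'} ≤ F.edgeSet.ncard := fun c => by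
    have hEfin : (E c).Finite := (Set.toFinite _).image _
    rw [← Set.ncard_coe_finset]
    calc ((({c' | ∃ e ∈ E c, g e ∈ E c'} : Finset ι) : Set ι)).ncard
        ≤ ((fun e => copyIndex (g e)) '' E c).ncard := by
          refine Set.ncard_le_ncard (fun c' hc' => ?_) (hEfin.image _)
          obtain ⟨e, he, hge⟩ := (Finset.mem_filter.1 hc').2
          exact ⟨e, he, hE c' _ hge⟩
      _ ≤ (E c).ncard := Set.ncard_image_le hEfin
      _ ≤ F.edgeSet.ncard := Set.ncard_image_le (Set.toFinite _)
  obtain ⟨B, -, hBm, hB⟩ := exists_pairwise_not_rel_of_outDegree_le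
    (fun c c' => ∃ e ∈ E c, g e ∈ E c') (fun c _ => hdeg c) hm
  let f : Fin m ↪ ι :=
    (B.equivFinOfCardEq hBm).symm.toEmbedding.trans (Function.Embedding.subtype _)
  refine ⟨assembleCopies φ f, ?_⟩
  rw [image_assembleCopies]
  simp only [Set.Pairwise, Set.mem_iUnion]
  rintro e ⟨a, he⟩ e' ⟨b, he'⟩ hne
  by_cases hab : f a = f b
  · exact hφ (f a) he (hab ▸ he') hne
  · rintro rfl
    exact hB (Subtype.coe_prop _) (Subtype.coe_prop _) hab ⟨e, he, he'⟩

theorem unavoidable_self_of_subsingleton_edgeSet {W : Type*} {F : SimpleGraph W}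
    (hF : F.edgeSet.Subsingleton) : Unavoidable F F :=
  unavoidable_iff.2 fun _ => ⟨Copy.id F, (hF.image _).pairwise _⟩

theorem unavoidable_matchingGraph (t : ℕ) :
    Unavoidable (matchingGraph (3 * t)) (matchingGraph t) := by
  have hone : (⊤ : SimpleGraph (Fin 2)).edgeSet.ncard = 1 := by
    rw [Set.ncard_eq_toFinset_card']
    exact card_edgeFinset_top_eq_card_choose_two
  have hK₂ : Unavoidable (⊤ : SimpleGraph (Fin 2)) (⊤ : SimpleGraph (Fin 2)) :=
    unavoidable_self_of_subsingleton_edgeSet (Set.ncard_le_one_iff_subsingleton.1 hone.le)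
  rw [matchingGraph_eq_disjointCopies, matchingGraph_eq_disjointCopies]
  exact hK₂.disjointCopies (by rw [hone, Fintype.card_fin])

theorem not_unavoidable_of_forall_comap {ι V W : Type*} {F : SimpleGraph W} (hF : F.Connected)
    {H : SimpleGraph (ι × V)} (hH : ∀ x y, H.Adj x y → x.1 = y.1)
    (h : ∀ c, ¬ Unavoidable (H.comap (Prod.mk c)) F) : ¬ Unavoidable H F := by
  simp only [unavoidable_iff, not_forall, not_exists] at h ⊢
  choose g hg using h
  refine ⟨fun e => (g (copyIndex e) (e.map Prod.snd)).map (Prod.mk (copyIndex e)),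
    fun φ hφ => ?_⟩
  obtain ⟨w₀⟩ := hF.nonempty
  have hfst : ∀ w, (φ w).1 = (φ w₀).1 := fun w => by
    obtain ⟨p⟩ := hF.preconnected w w₀
    induction p with
    | nil => rfl
    | cons huv _ ih => exact (hH _ _ (φ.toHom.map_adj huv)).trans ih
  have hmk : Prod.mk (φ w₀).1 ∘ (fun w => (φ w).2) = φ :=
    funext fun w => Prod.ext (hfst w).symm rfl
  let ψ : Copy F (H.comap (Prod.mk (φ w₀).1)) :=
    ⟨⟨fun w => (φ w).2, fun {u v} huv => by
      have := φ.toHom.map_adj huv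
      exact (congrFun hmk u ▸ congrFun hmk v ▸ this : H.Adj _ _)⟩,
      Function.Injective.of_comp (f := Prod.mk (φ w₀).1) (hmk ▸ φ.injective)⟩
  refine hg (φ w₀).1 ψ ?_
  have hinj : Function.Injective (Sym2.map (Prod.mk (β := V) (φ w₀).1)) :=
    Sym2.map.injective (Prod.mk_right_injective _)
  rw [← hmk, Sym2.map_comp, Set.image_comp, hinj.injOn.pairwise_image] at hφ
  refine hφ.mono' fun e e' hne heq => hne ?_
  simp [copyIndex_map_mk, heq, Sym2.map_map]

/-! ### Unavoidability of matchings -/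

theorem exists_embedding_extension {V W : Type*} [Finite V] [Finite W] {s : Set W} (f : s ↪ V)
    (hc : Nat.card W ≤ Nat.card V) : ∃ φ : W ↪ V, ∀ w : s, φ w = f w := by
  classical
  have := Fintype.ofFinite V
  have := Fintype.ofFinite W
  simp only [Nat.card_eq_fintype_card] at hc
  obtain ⟨ι⟩ := Function.Embedding.nonempty_of_card_le hc
  let e : ι '' s ≃ Set.range f :=
    (Equiv.Set.image ι s ι.injective).symm.trans (Equiv.ofInjective f f.injective)
  refine ⟨ι.trans (Equiv.extendSubtype e).toEmbedding, fun w => ?_⟩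
  have hw : ι w ∈ ι '' s := Set.mem_image_of_mem ι w.2
  calc Equiv.extendSubtype e (ι w) = e ⟨ι w, hw⟩ := Equiv.extendSubtype_apply_of_mem e _ hw
    _ = f w := by simp [e, Equiv.Set.image_symm_apply]

theorem exists_copy_extension {V W : Type*} [Finite V] [Finite W] {G : SimpleGraph V}
    {F : SimpleGraph W} (ψ : Copy (F.induce F.support) G) (hc : Nat.card W ≤ Nat.card V) :
    ∃ φ : Copy F G, Sym2.map φ '' F.edgeSet = Sym2.map ψ '' (F.induce F.support).edgeSet := by
  obtain ⟨φ, hφ⟩ := exists_embedding_extension ψ.toEmbedding hc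
  have hφ : ∀ {w} (hw : w ∈ F.support), φ w = ψ ⟨w, hw⟩ := fun hw => hφ ⟨_, hw⟩
  refine ⟨⟨⟨φ, fun {u v} huv => ?_⟩, φ.injective⟩, Set.Subset.antisymm ?_ ?_⟩
  · rw [hφ huv.left_mem_support, hφ huv.right_mem_support]
    exact ψ.toHom.map_adj huv
  · rintro _ ⟨⟨u, v⟩, huv, rfl⟩
    have huv : F.Adj u v := huv
    exact ⟨s(⟨u, huv.left_mem_support⟩, ⟨v, huv.right_mem_support⟩), huv,
      congrArg₂ Sym2.mk (hφ huv.left_mem_support).symm (hφ huv.right_mem_support).symm⟩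
  · rintro _ ⟨⟨⟨u, hu⟩, ⟨v, hv⟩⟩, huv, rfl⟩
    exact ⟨s(u, v), huv, congrArg₂ Sym2.mk (hφ hu) (hφ hv)⟩

theorem Unavoidable.of_induce_support {V W : Type*} [Finite V] [Finite W] {G : SimpleGraph V}
    {F : SimpleGraph W} (h : Unavoidable G (F.induce F.support)) (hc : Nat.card W ≤ Nat.card V) :
    Unavoidable G F := by
  refine unavoidable_iff.2 fun g => ?_
  obtain ⟨ψ, hψ⟩ := h.exists_free_copy g
  obtain ⟨φ, hφ⟩ := exists_copy_extension ψ hc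
  exact ⟨φ, hφ ▸ hψ⟩

theorem matchingGraph_succ_isContained {V : Type*} {G : SimpleGraph V} {t : ℕ}
    (ψ : Copy (matchingGraph t) G) {u v : V} (huv : G.Adj u v) (hu : u ∉ Set.range ψ)
    (hv : v ∉ Set.range ψ) : matchingGraph (t + 1) ⊑ G := by
  let e : Fin (t + 1) → Fin 2 → V := Fin.cons ![u, v] fun a p => ψ (a, p)
  have hedge : ∀ p, ![u, v] p ∉ Set.range ψ := Fin.forall_fin_two.2 ⟨hu, hv⟩
  refine ⟨⟨⟨fun x => e x.1 x.2, ?_⟩, ?_⟩⟩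
  · rintro ⟨a, p⟩ ⟨b, q⟩ ⟨hab, hpq⟩
    obtain rfl : a = b := hab
    cases a using Fin.cases with
    | zero =>
      fin_cases p <;> fin_cases q
      exacts [absurd rfl hpq, huv, huv.symm, absurd rfl hpq]
    | succ a => exact ψ.toHom.map_adj ⟨rfl, hpq⟩
  · rintro ⟨a, p⟩ ⟨b, q⟩ (h : e a p = e b q)
    cases a using Fin.cases <;> cases b using Fin.cases
    · fin_cases p <;> fin_cases q
      exacts [rfl, absurd h huv.ne, absurd h huv.ne', rfl]
    · exact absurd ⟨_, h.symm⟩ (hedge p)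
    · exact absurd ⟨_, h⟩ (hedge q)
    · simpa using ψ.injective h

theorem exists_isVertexCover_of_not_matchingGraph_isContained {V : Type*} [Finite V]
    {G : SimpleGraph V} {t : ℕ} (h : ¬ matchingGraph t ⊑ G) :
    ∃ C : Finset V, #C ≤ 2 * t ∧ G.IsVertexCover C := by
  classical
  induction t with
  | zero => exact absurd IsContained.of_isEmpty h
  | succ t ih =>
    by_cases ht : matchingGraph t ⊑ G
    · obtain ⟨ψ⟩ := ht
      refine ⟨Finset.univ.image ψ, ?_, fun u v huv => ?_⟩
      · refine Finset.card_image_le.trans ?_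
        simp only [Finset.card_univ, Fintype.card_prod, Fintype.card_fin]
        omega
      · by_contra! hcon
        exact h (matchingGraph_succ_isContained ψ huv (by simpa using hcon.1)
          (by simpa using hcon.2))
    · obtain ⟨C, hC, hcover⟩ := ih ht
      exact ⟨C, by omega, hcover⟩

theorem MinimalUnavoidable.card_le_of_matchingGraph_isContained {V W : Type*} [Finite V] [Finite W]
    {G : SimpleGraph V} {F : SimpleGraph W} {t : ℕ} (i : F.induce F.support ≃g matchingGraph t)
    (hG : MinimalUnavoidable G F) (hcont : matchingGraph (3 * t) ⊑ G) :
    Nat.card V ≤ 2 * (3 * t) + Nat.card W := by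
  classical
  have := Fintype.ofFinite V
  by_contra! hlt
  obtain ⟨ψ⟩ := hcont
  obtain ⟨s, hψs, -, hs⟩ := Finset.exists_subsuperset_card_eq
    (Finset.subset_univ (Finset.univ.image ψ)) (n := 2 * (3 * t) + Nat.card W)
    (Finset.card_image_le.trans
      (by simp only [Finset.card_univ, Fintype.card_prod, Fintype.card_fin]; omega))
    (by simpa using hlt.le)
  have hψs : ∀ x, ψ x ∈ s := fun x => hψs (Finset.mem_image_of_mem ψ (Finset.mem_univ x))
  have hmatching : matchingGraph (3 * t) ⊑ G.induce (s : Set V) :=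
    ⟨⟨⟨fun x => ⟨ψ x, hψs x⟩, fun h => ψ.toHom.map_adj h⟩,
      fun x y h => ψ.injective (congrArg Subtype.val h)⟩⟩
  have hunavoidable : Unavoidable (G.induce (s : Set V)) F :=
    (((unavoidable_matchingGraph t).mono hmatching).anti_right i.isContained).of_induce_support
      (by simp [hs])
  obtain ⟨j⟩ := hG.nonempty_iso hunavoidable (Embedding.induce _).isContained
  have := Nat.card_congr j.toEquiv
  simp only [SetLike.coe_sort_coe, Nat.card_eq_fintype_card, Fintype.card_coe, hs] at this hlt
  omega

theorem MinimalUnavoidable.exists_isVertexCover {V W : Type*} [Finite V] [Finite W]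
    {G : SimpleGraph V} {F : SimpleGraph W} {t : ℕ} (i : F.induce F.support ≃g matchingGraph t)
    (hG : MinimalUnavoidable G F) :
    ∃ C : Finset V, #C ≤ 2 * (3 * t) + Nat.card W ∧ G.IsVertexCover C := by
  have := Fintype.ofFinite V
  by_cases hcont : matchingGraph (3 * t) ⊑ G
  · refine ⟨Finset.univ, ?_, by simp⟩
    simpa using hG.card_le_of_matchingGraph_isContained i hcont
  · obtain ⟨C, hC, hcover⟩ := exists_isVertexCover_of_not_matchingGraph_isContained hcont
    exact ⟨C, by omega, hcover⟩

/-! ### Graphs with a bounded vertex cover -/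

theorem exists_embedding_comp_eq {α β γ : Type*} [Finite α] [Finite β] (f : α → γ) (f' : β → γ)
    (h : ∀ c, Nat.card {a // f a = c} ≤ Nat.card {b // f' b = c}) :
    ∃ φ : α ↪ β, ∀ a, f' (φ a) = f a := by
  have hfiber : ∀ c, Nonempty ({a // f a = c} ↪ {b // f' b = c}) := fun c => by
    have := Fintype.ofFinite {a // f a = c}
    have := Fintype.ofFinite {b // f' b = c}
    exact Function.Embedding.nonempty_of_card_le
      (by simpa only [Nat.card_eq_fintype_card] using h c)
  let φ : α ↪ β := (Equiv.sigmaFiberEquiv f).symm.toEmbedding.trans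
    ((Function.Embedding.sigmaMap (Function.Embedding.refl γ) fun c => (hfiber c).some).trans
      (Equiv.sigmaFiberEquiv f').toEmbedding)
  exact ⟨φ, fun a => ((hfiber (f a)).some ⟨a, rfl⟩).2⟩

/-- The label of a vertex with respect to a family of vertices `κ`: the indices of the vertex itself
and those of its neighbours. If `κ` runs over a vertex cover, the labels determine the graph. -/
def coverLabel {α V : Type*} (G : SimpleGraph V) (κ : α → V) (v : V) : Set α × Set α :=
  ({a | κ a = v}, {a | G.Adj (κ a) v})

theorem adj_of_coverLabel_eq {α V V' : Type*} {G : SimpleGraph V} {G' : SimpleGraph V'}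
    {κ : α → V} {κ' : α → V'} (hκ : G.IsVertexCover (Set.range κ)) {φ : V → V'}
    (hφ : ∀ v, coverLabel G' κ' (φ v) = coverLabel G κ v) {u v : V} (huv : G.Adj u v) :
    G'.Adj (φ u) (φ v) := by
  wlog hu : u ∈ Set.range κ generalizing u v
  · exact (this huv.symm ((hκ huv).resolve_left hu)).symm
  obtain ⟨a, rfl⟩ := hu
  have hfst : κ' a = φ (κ a) :=
    (Set.ext_iff.1 (congrArg Prod.fst (hφ (κ a))) a).2 rfl
  have hsnd : G'.Adj (κ' a) (φ v) := (Set.ext_iff.1 (congrArg Prod.snd (hφ v)) a).2 huv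
  rwa [← hfst]

theorem isContained_of_card_coverLabel_le {α V V' : Type*} [Finite V] [Finite V']
    {G : SimpleGraph V} {G' : SimpleGraph V'} {κ : α → V} {κ' : α → V'}
    (hκ : G.IsVertexCover (Set.range κ))
    (h : ∀ l, Nat.card {v // coverLabel G κ v = l} ≤ Nat.card {v // coverLabel G' κ' v = l}) :
    G ⊑ G' := by
  obtain ⟨φ, hφ⟩ := exists_embedding_comp_eq (coverLabel G κ) (coverLabel G' κ') h
  exact ⟨⟨⟨φ, adj_of_coverLabel_eq hκ hφ⟩, φ.injective⟩⟩

/-- By Dickson's lemma, the label counts of two of infinitely many graphs would be comparable. -/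
theorem finite_minimalUnavoidableGraphs_of_cover {W : Type*} (F : SimpleGraph W) (α : Type*)
    [Finite α] :
    {x : FiniteGraphClass | ∃ G : Σ n : ℕ, SimpleGraph (Fin n), ⟦G⟧ = x ∧
      MinimalUnavoidable G.2 F ∧ ∃ κ : α → Fin G.1, G.2.IsVertexCover (Set.range κ)}.Finite := by
  by_contra hinf
  let x := Set.Infinite.natEmbedding _ hinf
  choose G hG hmin κ hκ using fun m => (x m).2
  obtain ⟨i, j, hij, hle⟩ := wellQuasiOrdered_le fun (m : ℕ) (l : Set α × Set α) =>
    Nat.card {v // coverLabel (G m).2 (κ m) v = l}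
  have hiso : Nonempty ((G i).2 ≃g (G j).2) :=
    (hmin j).nonempty_iso (hmin i).1 (isContained_of_card_coverLabel_le (hκ i) hle)
  refine hij.ne (x.injective (Subtype.ext ?_))
  rw [← hG i, ← hG j]
  exact Quotient.sound hiso

theorem finite_minimalUnavoidableGraphs {W : Type*} [Finite W] {F : SimpleGraph W} {t : ℕ}
    (i : F.induce F.support ≃g matchingGraph t) : (minimalUnavoidableGraphs F).Finite := by
  refine ((Set.finite_Iic (2 * (3 * t) + Nat.card W)).biUnion fun c _ =>
    finite_minimalUnavoidableGraphs_of_cover F (Fin c)).subset ?_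
  rintro _ ⟨G, rfl, hG⟩
  obtain ⟨C, hC, hcover⟩ := hG.exists_isVertexCover i
  refine Set.mem_biUnion hC ⟨G, rfl, hG, Subtype.val ∘ C.equivFin.symm, ?_⟩
  rwa [Set.range_comp, C.equivFin.symm.surjective.range_eq, Set.image_univ, Subtype.range_coe]

/-! ### Forests that are not star forests -/

theorem exists_adj_imp_eq_of_isAcyclic {V : Type*} {G : SimpleGraph V} (hG : G.IsAcyclic)
    {S : Finset V} (hS : S.Nonempty) : ∃ x ∈ S, ∃ y, ∀ u ∈ S, G.Adj x u → u = y := by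
  let H := G.induce (S : Set V)
  have : Nonempty (S : Set V) := hS.to_subtype
  obtain ⟨x, _, p, hp, hmax⟩ := Walk.exists_isPath_forall_isPath_length_le_length H
  refine ⟨x, x.2, p.snd, fun u hu hxu => ?_⟩
  have hxu : H.Adj x ⟨u, hu⟩ := hxu
  refine congrArg Subtype.val ((hG.induce _).eq_snd_of_adj_start hp hxu ?_)
  by_contra hnotMem
  have := hmax _ _ (Walk.cons hxu.symm p) (hp.cons hnotMem)
  simp at this

theorem finset_induction_of_isAcyclic {V : Type*} [DecidableEq V] {G : SimpleGraph V}
    (hG : G.IsAcyclic) {P : Finset V → Prop} (empty : P ∅)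
    (insert : ∀ x S, x ∉ S → ∀ y, (∀ u ∈ S, G.Adj x u → u = y) → P S → P (insert x S))
    (S : Finset V) : P S := by
  induction S using Finset.strongInduction with
  | H S ih =>
    rcases S.eq_empty_or_nonempty with rfl | hS
    · exact empty
    obtain ⟨x, hx, y, hy⟩ := exists_adj_imp_eq_of_isAcyclic hG hS
    rw [← Finset.insert_erase hx]
    exact insert x _ (Finset.notMem_erase x S) y (fun u hu => hy u (Finset.mem_of_mem_erase hu))
      (ih _ (Finset.erase_ssubset hx))

/-- The graph in which every vertex `x` is joined to its parent `r x`. -/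
def functionalGraph {V : Type*} (r : V → V) : SimpleGraph V :=
  SimpleGraph.fromRel fun x y => r x = y

theorem functionalGraph_adj {V : Type*} {r : V → V} {u v : V} :
    (functionalGraph r).Adj u v ↔ u ≠ v ∧ (r u = v ∨ r v = u) :=
  SimpleGraph.fromRel_adj _ _ _

theorem exists_le_functionalGraph_of_isAcyclic {V : Type*} [Finite V] {G : SimpleGraph V}
    (hG : G.IsAcyclic) : ∃ p : V → V, G ≤ functionalGraph p := by
  classical
  have := Fintype.ofFinite V
  suffices h : ∀ S : Finset V, ∃ p : V → V, ∀ u ∈ S, ∀ v ∈ S, G.Adj u v → p u = v ∨ p v = u by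
    obtain ⟨p, hp⟩ := h Finset.univ
    exact ⟨p, fun u v huv =>
      functionalGraph_adj.2 ⟨huv.ne, hp u (Finset.mem_univ u) v (Finset.mem_univ v) huv⟩⟩
  refine finset_induction_of_isAcyclic hG ⟨id, by simp⟩ ?_
  rintro x S hx y hy ⟨p, hp⟩
  refine ⟨Function.update p x y, fun u hu v hv huv => ?_⟩
  rcases Finset.mem_insert.1 hu with rfl | huS <;> rcases Finset.mem_insert.1 hv with rfl | hvS
  · exact absurd rfl huv.ne
  · exact Or.inl (by simp [hy v hvS huv])
  · exact Or.inr (by simp [hy u huS huv.symm])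
  · have hux : u ≠ x := fun h => hx (h ▸ huS)
    have hvx : v ≠ x := fun h => hx (h ▸ hvS)
    simpa [hux, hvx] using hp u huS v hvS huv

/-- A forest all of whose components are stars, phrased as: every edge has an end of degree one. -/
def IsStarForest {W : Type*} (F : SimpleGraph W) : Prop :=
  ∀ u v, F.Adj u v → (∀ w, F.Adj u w → w = v) ∨ ∀ w, F.Adj v w → w = u

/-- The edge of `functionalGraph r` that joins `x` to its parent; a loop if `r x = x`. -/
abbrev parentEdge {V : Type*} (r : V → V) (x : V) : Sym2 V :=
  s(x, r x)

/-- Send the edge from `v` to its parent to the edge from the parent to the grandparent. -/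
theorem not_unavoidable_functionalGraph {V W : Type*} {F : SimpleGraph W} (hF : ¬ IsStarForest F)
    (p : V → V) : ¬ Unavoidable (functionalGraph p) F := by
  intro h
  let g : Sym2 V → Sym2 V := Function.extend (parentEdge p) (fun v => parentEdge p (p v)) id
  have hg : ∀ v, g s(v, p v) = s(p v, p (p v)) := by
    refine Function.FactorsThrough.extend_apply (fun v w hvw => ?_) id
    rcases Sym2.eq_iff.1 hvw with ⟨rfl, -⟩ | ⟨hv, hw⟩
    · rfl
    · rw [hw, ← hv, hvw]
  obtain ⟨φ, hφ⟩ := h.exists_free_copy g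
  have hparent : ∀ {x y}, F.Adj x y → p (φ x) = φ y ∨ p (φ y) = φ x := fun hxy =>
    (functionalGraph_adj.1 (φ.toHom.map_adj hxy)).2
  have hfree : ∀ {x y z}, F.Adj x y → F.Adj y z → x ≠ z → p (φ y) ≠ φ z := by
    intro x y z hxy hyz hxz hpy
    have hpx : p (φ x) = φ y :=
      (hparent hxy).resolve_right fun h => hxz (φ.injective (h.symm.trans hpy))
    refine hφ (Set.mem_image_of_mem _ (F.mem_edgeSet.2 hxy))
      (Set.mem_image_of_mem _ (F.mem_edgeSet.2 hyz)) (fun h => ?_) ?_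
    · rcases Sym2.eq_iff.1 (Sym2.map.injective φ.injective h) with h | h
      exacts [hxy.ne h.1, hxz h.1]
    · rw [Sym2.map_mk, Sym2.map_mk, ← hpx, hg, hpx, hpy]
  simp only [IsStarForest] at hF
  push Not at hF
  obtain ⟨u, v, huv, ⟨a, hua, hav⟩, b, hvb, hbu⟩ := hF
  rcases hparent huv with h | h
  · exact hfree hua.symm huv hav h
  · exact hfree hvb.symm huv.symm hbu h

theorem not_unavoidable_of_isAcyclic {V W : Type*} [Finite V] {G : SimpleGraph V}
    {F : SimpleGraph W} (hG : G.IsAcyclic) (hF : ¬ IsStarForest F) : ¬ Unavoidable G F := by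
  obtain ⟨p, hp⟩ := exists_le_functionalGraph_of_isAcyclic hG
  exact fun h => not_unavoidable_functionalGraph hF p (h.mono (IsContained.of_le hp))

theorem isContained_of_isAcyclic_of_le_degree {V W : Type*} [Nonempty V] [Fintype W]
    {F : SimpleGraph W} (hF : F.IsAcyclic) {G : SimpleGraph V} [G.LocallyFinite]
    (hdeg : ∀ v, Fintype.card W ≤ G.degree v) : F ⊑ G := by
  classical
  suffices h : ∀ T : Finset W, ∃ φ : W → V, Set.InjOn φ T ∧
      ∀ x ∈ T, ∀ y ∈ T, F.Adj x y → G.Adj (φ x) (φ y) by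
    obtain ⟨φ, hinj, hadj⟩ := h Finset.univ
    simp only [Finset.coe_univ, Set.injOn_univ, Finset.mem_univ, true_imp_iff] at hinj hadj
    exact ⟨⟨⟨φ, fun h => hadj _ _ h⟩, hinj⟩⟩
  refine finset_induction_of_isAcyclic hF ⟨Classical.arbitrary _, by simp⟩ ?_
  rintro x T hx y hy ⟨φ, hinj, hadj⟩
  obtain ⟨z, hz, hzT⟩ : ∃ z ∈ G.neighborFinset (φ y), z ∉ T.image φ := by
    refine Finset.exists_mem_notMem_of_card_lt_card (Finset.card_image_le.trans_lt ?_)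
    exact (Finset.card_lt_univ_of_notMem hx).trans_le (hdeg (φ y))
  rw [mem_neighborFinset] at hz
  have hupdate : Set.EqOn (Function.update φ x z) φ T := fun u hu =>
    Function.update_of_ne (ne_of_mem_of_not_mem (Finset.mem_coe.1 hu) hx) z φ
  refine ⟨Function.update φ x z, ?_, fun u hu v hv huv => ?_⟩
  · rw [Finset.coe_insert, Set.injOn_insert (by simpa), hupdate.injOn_iff, hupdate.image_eq]
    exact ⟨hinj, by simpa using hzT⟩
  · rcases Finset.mem_insert.1 hu with rfl | huT <;> rcases Finset.mem_insert.1 hv with rfl | hvT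
    · exact absurd rfl huv.ne
    · rw [Function.update_self, hupdate hvT, hy v hvT huv]
      exact hz.symm
    · rw [Function.update_self, hupdate huT, hy u huT huv.symm]
      exact hz
    · rw [hupdate huT, hupdate hvT]
      exact hadj u huT v hvT huv

theorem isContained_of_isAcyclic_of_card_edgeFinset {V W : Type*} [Fintype V] [Nonempty V]
    [Fintype W] {F : SimpleGraph W} (hF : F.IsAcyclic) {G : SimpleGraph V} [DecidableRel G.Adj]
    (hG : Fintype.card W * Fintype.card V ≤ #G.edgeFinset) : F ⊑ G := by
  classical
  induction hn : Fintype.card V generalizing V with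
  | zero => exact absurd hn Fintype.card_ne_zero
  | succ n ih =>
    by_cases hdeg : ∀ v, Fintype.card W ≤ G.degree v
    · exact isContained_of_isAcyclic_of_le_degree hF hdeg
    push Not at hdeg
    obtain ⟨v, hv⟩ := hdeg
    rw [hn, mul_add_one] at hG
    have hcard : Fintype.card ({v}ᶜ : Set V) = n := by
      rw [Fintype.card_compl_set, hn, Set.card_singleton, Nat.add_sub_cancel]
    have hpos : 0 < n := by
      by_contra hzero
      have hle : #G.edgeFinset ≤ (Fintype.card V).choose 2 := card_edgeFinset_le_card_choose_two
      rw [Nat.choose_eq_zero_of_lt (by omega)] at hle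
      omega
    have : Nonempty ({v}ᶜ : Set V) := Fintype.card_pos_iff.1 (hcard ▸ hpos)
    refine (ih (G := G.induce {v}ᶜ) ?_ hcard).trans (Embedding.induce _).isContained
    rw [card_edgeFinset_induce_compl_singleton, card_edgeFinset_deleteIncidenceSet, hcard]
    omega

theorem unavoidable_of_card_edgeFinset {V W : Type*} [Fintype V] [Nonempty V] [Fintype W]
    {F : SimpleGraph W} {G : SimpleGraph V} [DecidableRel G.Adj] (hF : F.IsAcyclic)
    (hG : 3 * (Fintype.card W * Fintype.card V) ≤ #G.edgeFinset) : Unavoidable G F := by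
  classical
  refine unavoidable_iff.2 fun g => ?_
  obtain ⟨B, hBG, hBcard, hB⟩ := exists_pairwise_apply_ne g hG
  let H : SimpleGraph V := fromEdgeSet B
  have hHG : H ≤ G := G.fromEdgeSet_edgeSet ▸ fromEdgeSet_mono fun e he => mem_edgeFinset.1 (hBG he)
  have hcard : Fintype.card W * Fintype.card V ≤ #(@edgeFinset V H (fintypeEdgeSet H)) := by
    refine hBcard.ge.trans (Finset.card_le_card fun e he => ?_)
    simpa [H, he] using G.not_isDiag_of_mem_edgeFinset (hBG he)
  obtain ⟨φ⟩ := isContained_of_isAcyclic_of_card_edgeFinset hF hcard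
  refine ⟨(Copy.ofLE _ _ hHG).comp φ, hB.mono ?_⟩
  exact (image_edgeSet_subset φ).trans ((edgeSet_fromEdgeSet _).trans_subset Set.sdiff_subset)

/-! ### Dense graphs that are locally acyclic -/

/-- Every set of at most `N` vertices induces an acyclic graph, so that `G` looks like a forest to
its small subgraphs, however many edges it has. -/
def LocallyAcyclic {V : Type*} (N : ℕ) (G : SimpleGraph V) : Prop :=
  ∀ S : Finset V, #S ≤ N → (G.induce (S : Set V)).IsAcyclic

theorem LocallyAcyclic.isAcyclic_of_isContained {U V : Type*} [Fintype U] {K : SimpleGraph U}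
    {G : SimpleGraph V} {N : ℕ} (hG : LocallyAcyclic N G) (hU : Fintype.card U ≤ N) (hK : K ⊑ G) :
    K.IsAcyclic := by
  classical
  obtain ⟨ψ⟩ := hK
  refine (hG (Finset.univ.image ψ) (Finset.card_image_le.trans hU)).comap
    ⟨fun x => ⟨ψ x, by simp⟩, fun h => ψ.toHom.map_adj h⟩ fun x y h => ?_
  exact ψ.injective (congrArg Subtype.val h)

theorem LocallyAcyclic.sup_edge {V : Type*} {G : SimpleGraph V} {N : ℕ} {u v : V}
    (hG : LocallyAcyclic N G) (huv : ∀ p : G.Walk u v, N ≤ p.length) :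
    LocallyAcyclic N (G ⊔ edge u v) := by
  classical
  intro S hS
  by_cases hmem : u ∈ S ∧ v ∈ S
  · have hnot : ¬ (G.induce (S : Set V)).Reachable ⟨u, hmem.1⟩ ⟨v, hmem.2⟩ := by
      rintro ⟨p⟩
      have hlt : p.bypass.length < Fintype.card (S : Set V) := p.bypass_isPath.length_lt
      have hle := (huv (p.bypass.map (Embedding.induce (S : Set V)).toHom)).trans_eq
        (Walk.length_map _ _)
      have hcard : Fintype.card (S : Set V) = #S := Fintype.card_coe S
      omega
    refine ((hG S hS).sup_edge_of_not_reachable hnot).anti fun x y hxy => ?_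
    simp only [comap_adj, Function.Embedding.subtype_apply, sup_adj, edge_adj, Subtype.ext_iff,
      ne_eq] at hxy ⊢
    exact hxy
  · refine (hG S hS).anti fun x y hxy => ?_
    rcases hxy with hxy | hxy
    · exact hxy
    · rcases (edge_adj _ _ _ _).1 hxy with ⟨⟨hxu, hyv⟩ | ⟨hxv, hyu⟩, -⟩
      · exact absurd ⟨hxu ▸ x.2, hyv ▸ y.2⟩ hmem
      · exact absurd ⟨hyu ▸ y.2, hxv ▸ x.2⟩ hmem

theorem ncard_setOf_walk_length_le {V : Type*} [Fintype V] {G : SimpleGraph V} [DecidableRel G.Adj]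
    {D : ℕ} (hD : ∀ v, G.degree v ≤ D) (u : V) (N : ℕ) :
    {v | ∃ p : G.Walk u v, p.length ≤ N}.ncard ≤ (D + 1) ^ N := by
  classical
  suffices h : ∃ B : Finset V, {v | ∃ p : G.Walk u v, p.length ≤ N} ⊆ B ∧ #B ≤ (D + 1) ^ N by
    obtain ⟨B, hB, hcard⟩ := h
    exact (Set.ncard_le_ncard hB B.finite_toSet).trans (by rwa [Set.ncard_coe_finset])
  induction N with
  | zero =>
    refine ⟨{u}, fun v ⟨p, hp⟩ => ?_, by simp⟩
    simp [Walk.eq_of_length_eq_zero (Nat.le_zero.1 hp)]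
  | succ N ih =>
    obtain ⟨B, hwalk, hB⟩ := ih
    refine ⟨B.biUnion fun w => insert w (G.neighborFinset w), fun v ⟨p, hp⟩ => ?_, ?_⟩
    · rw [Finset.mem_coe, Finset.mem_biUnion]
      by_cases hpN : p.length ≤ N
      · exact ⟨v, hwalk ⟨p, hpN⟩, Finset.mem_insert_self v _⟩
      · have hnil : ¬ p.Nil := fun h => hpN (by simp [Walk.length_eq_zero_iff.2 h])
        have hlength : p.dropLast.length ≤ N := by
          simp only [Walk.length_dropLast, tsub_le_iff_right]
          exact hp
        refine ⟨p.penultimate, hwalk ⟨p.dropLast, hlength⟩, Finset.mem_insert_of_mem ?_⟩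
        exact (G.mem_neighborFinset _ _).2 (p.adj_penultimate hnil)
    · refine (Finset.card_biUnion_le_card_mul _ _ (D + 1) fun w _ => ?_).trans
        ((Nat.mul_le_mul_right _ hB).trans_eq (pow_succ _ _).symm)
      exact (Finset.card_insert_le _ _).trans (Nat.succ_le_succ (hD w))

theorem degree_sup_edge_le {V : Type*} [Fintype V] [DecidableEq V] (G : SimpleGraph V)
    [DecidableRel G.Adj] (u v : V) {_ : DecidableRel (G ⊔ edge u v).Adj} (w : V) :
    (G ⊔ edge u v).degree w ≤ G.degree w + if w = u ∨ w = v then 1 else 0 := by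
  simp only [← card_neighborFinset_eq_degree]
  split_ifs with hw
  · refine (Finset.card_le_card (t := insert (if w = u then v else u) (G.neighborFinset w))
      fun x hx => ?_).trans (Finset.card_insert_le _ _)
    simp only [mem_neighborFinset, sup_adj, edge_adj, Finset.mem_insert] at hx ⊢
    grind
  · refine Finset.card_le_card fun x hx => ?_
    simp only [mem_neighborFinset, sup_adj, edge_adj] at hx ⊢
    grind

open Classical in
/-- Two vertices of degree less than `D` could be joined unless they are at distance at most
`N + 1`, so all of them lie in one ball. -/
theorem card_degree_lt_le_of_maximal {V : Type*} [Fintype V] {G : SimpleGraph V} {N D : ℕ}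
    (hG : Maximal (fun H : SimpleGraph V => (∀ v, H.degree v ≤ D) ∧ LocallyAcyclic N H) G) :
    #{v | G.degree v < D} ≤ (D + 1) ^ (N + 1) := by
  obtain ⟨hdeg, hloc⟩ := hG.prop
  rcases Finset.eq_empty_or_nonempty {v | G.degree v < D} with hempty | ⟨u, hu⟩
  · simp [hempty]
  refine le_trans ?_ (ncard_setOf_walk_length_le hdeg u (N + 1))
  rw [← Set.ncard_coe_finset]
  refine Set.ncard_le_ncard (fun v hv => ?_) (Set.toFinite _)
  simp only [Finset.coe_filter, Finset.mem_filter, Finset.mem_univ, true_and,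
    Set.mem_ofPred_eq] at hu hv ⊢
  by_contra! hfar
  have hne : u ≠ v := by
    rintro rfl
    simpa using hfar Walk.nil
  have hnadj : ¬ G.Adj u v := fun h => by simpa using hfar h.toWalk
  refine hnadj (hG.le_of_ge ⟨fun w => ?_, hloc.sup_edge fun p => by have := hfar p; omega⟩
    le_sup_left (by simp [edge_adj, hne] : (G ⊔ edge u v).Adj u v))
  refine (degree_sup_edge_le G u v w).trans ?_
  split_ifs with hw
  · rcases hw with rfl | rfl <;> omega
  · exact hdeg w

theorem exists_locallyAcyclic (N d : ℕ) : ∃ (n : ℕ) (G : SimpleGraph (Fin n))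
    (_ : DecidableRel G.Adj), 0 < n ∧ d * n ≤ #G.edgeFinset ∧ LocallyAcyclic N G := by
  classical
  let D := 4 * d
  let n := 2 * (D + 1) ^ (N + 1)
  obtain ⟨G, hG⟩ := (Set.toFinite {G : SimpleGraph (Fin n) |
    (∀ v, G.degree v ≤ D) ∧ LocallyAcyclic N G}).exists_maximal
      ⟨⊥, by simp, fun S _ => isAcyclic_bot.induce _⟩
  refine ⟨n, G, inferInstance, by positivity, ?_, hG.prop.2⟩
  have hlow : #{v | G.degree v < D} ≤ (D + 1) ^ (N + 1) := card_degree_lt_le_of_maximal hG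
  have hsplit : #{v | G.degree v < D} + #{v | ¬ G.degree v < D} = n := by
    simpa using Finset.card_filter_add_card_filter_not (s := Finset.univ) fun v => G.degree v < D
  have hhigh : (D + 1) ^ (N + 1) * D ≤ #{v | ¬ G.degree v < D} * D :=
    Nat.mul_le_mul_right _ (by omega)
  have hsum : #{v | ¬ G.degree v < D} * D ≤ ∑ v, G.degree v :=
    (Finset.card_nsmul_le_sum _ (fun v => G.degree v) D fun v hv => by simpa using hv).trans
      (Finset.sum_le_sum_of_subset (Finset.filter_subset _ _))
  have hedges : 2 * (d * n) ≤ 2 * #G.edgeFinset := calc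
    2 * (d * n) = (D + 1) ^ (N + 1) * D := by simp only [n, D]; ring
    _ ≤ ∑ v, G.degree v := hhigh.trans hsum
    _ = 2 * #G.edgeFinset := G.sum_degrees_eq_twice_card_edges
  omega

theorem infinite_minimalUnavoidableGraphs_of_not_isStarForest {W : Type*} [Finite W]
    {F : SimpleGraph W} (hF : F.IsAcyclic) (hstar : ¬ IsStarForest F) :
    (minimalUnavoidableGraphs F).Infinite := by
  have := Fintype.ofFinite W
  refine infinite_minimalUnavoidableGraphs fun N => ?_
  obtain ⟨n, G, _, hn, hcard, hG⟩ := exists_locallyAcyclic N (3 * Fintype.card W)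
  have : Nonempty (Fin n) := ⟨⟨0, hn⟩⟩
  refine ⟨Fin n, inferInstance, G, unavoidable_of_card_edgeFinset hF ?_, fun m hm K hK => ?_⟩
  · rwa [Fintype.card_fin, ← mul_assoc]
  · exact not_unavoidable_of_isAcyclic (hG.isAcyclic_of_isContained (by simpa using hm) hK) hstar

/-! ### Stars and star forests -/

/-- Two arcs that stay among the edges at different vertices `v` and `w` have different tails, since
an edge is determined by two of its vertices. -/
theorem sum_card_internalArcs_incidenceFinset_le {V : Type*} [Fintype V] [DecidableEq V]
    {G : SimpleGraph V} [DecidableRel G.Adj] (g : Sym2 V → Sym2 V) (C : Finset V) :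
    ∑ v ∈ C, #(internalArcs g (G.incidenceFinset v)) ≤ #G.edgeFinset := by
  rw [← Finset.card_biUnion]
  · refine Finset.card_le_card (Finset.biUnion_subset.2 fun v _ => ?_)
    exact (Finset.filter_subset _ _).trans (G.incidenceFinset_subset v)
  · refine fun v _ w _ hvw => Finset.disjoint_left.2 fun e hev hew => ?_
    simp only [internalArcs, Finset.mem_filter, mem_incidenceFinset] at hev hew
    have he := (Sym2.mem_and_mem_iff hvw).1 ⟨hev.1.2, hew.1.2⟩
    have hge := (Sym2.mem_and_mem_iff hvw).1 ⟨hev.2.1.2, hew.2.1.2⟩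
    exact hev.2.2 (hge.trans he.symm)

theorem exists_copy_starGraph {V : Type*} {G : SimpleGraph V} {v : V} {B : Finset (Sym2 V)}
    (hB : ↑B ⊆ G.incidenceSet v) {k : ℕ} (hk : k ≤ #B) :
    ∃ φ : Copy (starGraph (none : Option (Fin k))) G,
      Sym2.map φ '' (starGraph (none : Option (Fin k))).edgeSet ⊆ B := by
  classical
  obtain ⟨f⟩ : Nonempty (Fin k ↪ B) := Function.Embedding.nonempty_of_card_le (by simpa using hk)
  choose leaf hleaf using fun i => Sym2.mem_iff_exists.1 (hB (f i).2).2
  let φ : Option (Fin k) → V := fun o => o.elim v leaf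
  have hleaf_mem : ∀ i, s(v, leaf i) ∈ B := fun i => hleaf i ▸ (f i).2
  have hadj : ∀ i, G.Adj v (leaf i) := fun i => (hB (hleaf_mem i)).1
  have hinj : Function.Injective φ := by
    rintro (_ | i) (_ | j) hij
    · rfl
    · exact absurd hij (hadj j).ne
    · exact absurd hij (hadj i).ne'
    · refine congrArg some (f.injective (Subtype.ext ?_))
      rw [hleaf i, hleaf j]
      exact congrArg _ hij
  have hedge : ∀ x y, (starGraph none).Adj x y → s(φ x, φ y) ∈ B := by
    rintro (_ | i) (_ | j) hxy
    · exact absurd rfl hxy.ne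
    · exact hleaf_mem j
    · exact Sym2.eq_swap ▸ hleaf_mem i
    · simp [starGraph_adj] at hxy
  refine ⟨⟨⟨φ, fun hxy => (hB (hedge _ _ hxy)).1⟩, hinj⟩, ?_⟩
  rintro _ ⟨⟨x, y⟩, hxy, rfl⟩
  exact hedge x y hxy

theorem unavoidable_starGraph {V : Type*} [Fintype V] {G : SimpleGraph V}
    [DecidableRel G.Adj] {k : ℕ} (C : Finset V)
    (hC : #G.edgeFinset + 3 * k * #C < 2 * ∑ v ∈ C, G.degree v) :
    Unavoidable G (starGraph (none : Option (Fin (k + 1)))) := by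
  classical
  refine unavoidable_iff.2 fun g => ?_
  choose B hBG hB hcard using fun v => exists_pairwise_apply_ne_of_internalArcs g
    (G.incidenceFinset v)
  obtain ⟨v, -, hv⟩ : ∃ v ∈ C, k < #(B v) := by
    by_contra! hsmall
    have hsum : 2 * ∑ v ∈ C, G.degree v ≤ 3 * k * #C + #G.edgeFinset := calc
      2 * ∑ v ∈ C, G.degree v
          ≤ ∑ v ∈ C, (3 * k + #(internalArcs g (G.incidenceFinset v))) := by
        rw [Finset.mul_sum]
        refine Finset.sum_le_sum fun v hv => ?_
        have := hcard v
        have := hsmall v hv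
        rw [card_incidenceFinset_eq_degree] at *
        omega
      _ ≤ 3 * k * #C + #G.edgeFinset := by
        rw [Finset.sum_add_distrib, Finset.sum_const, smul_eq_mul, mul_comm]
        exact Nat.add_le_add_left (sum_card_internalArcs_incidenceFinset_le g C) _
    omega
  obtain ⟨φ, hφ⟩ := exists_copy_starGraph (G := G) (v := v) (B := B v)
    (fun e he => (G.mem_incidenceFinset v e).1 (hBG v he)) hv
  exact ⟨φ, (hB v).mono hφ⟩

theorem parentEdge_injective {V : Type*} {r : V → V} (hr₂ : ∀ x, r (r x) ≠ x) :
    Function.Injective (parentEdge r) := by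
  intro x y hxy
  rcases Sym2.eq_iff.1 hxy with ⟨hxy, -⟩ | ⟨hx, hy⟩
  · exact hxy
  · exact absurd (hy ▸ hx.symm) (hr₂ x)

theorem parentEdge_mem_edgeSet {V : Type*} {r : V → V} {x : V} (hx : r x ≠ x) :
    parentEdge r x ∈ (functionalGraph r).edgeSet :=
  functionalGraph_adj.2 ⟨hx.symm, Or.inl rfl⟩

theorem edgeSet_functionalGraph_subset {V : Type*} (r : V → V) :
    (functionalGraph r).edgeSet ⊆ Set.range (parentEdge r) := by
  rintro ⟨x, y⟩ hxy
  rcases (functionalGraph_adj.1 hxy).2 with h | h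
  · exact ⟨x, Sym2.congr_right.2 h⟩
  · exact ⟨y, (Sym2.congr_right.2 h).trans Sym2.eq_swap⟩

theorem card_edgeFinset_functionalGraph_le {V : Type*} [Fintype V] (r : V → V)
    [Fintype (functionalGraph r).edgeSet] : #(functionalGraph r).edgeFinset ≤ Fintype.card V := by
  classical
  refine (Finset.card_le_card (t := Finset.univ.image (parentEdge r)) fun e he => ?_).trans
    Finset.card_image_le
  obtain ⟨x, rfl⟩ := edgeSet_functionalGraph_subset r (mem_edgeFinset.1 he)
  exact Finset.mem_image_of_mem _ (Finset.mem_univ x)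

theorem card_fiber_lt_degree_functionalGraph {V : Type*} [Fintype V] [DecidableEq V] {r : V → V}
    [DecidableRel (functionalGraph r).Adj] (hr : ∀ x, r x ≠ x) (hr₂ : ∀ x, r (r x) ≠ x) (v : V) :
    #{x | r x = v} < (functionalGraph r).degree v := by
  rw [← card_incidenceFinset_eq_degree]
  calc #{x | r x = v}
      < #(insert v ({x | r x = v} : Finset V)) :=
        Finset.card_lt_card (Finset.ssubset_insert (by simp [hr]))
    _ = #((insert v ({x | r x = v} : Finset V)).image (parentEdge r)) :=
        (Finset.card_image_of_injective _ (parentEdge_injective hr₂)).symm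
    _ ≤ #((functionalGraph r).incidenceFinset v) := by
        refine Finset.card_le_card fun e he => ?_
        obtain ⟨x, hx, rfl⟩ := Finset.mem_image.1 he
        refine (mem_incidenceFinset _ _ _).2 ⟨parentEdge_mem_edgeSet (hr x), ?_⟩
        simpa [eq_comm] using hx

theorem unavoidable_functionalGraph_starGraph {V : Type*} [Fintype V] {r : V → V} {k : ℕ}
    (hr : ∀ x, r x ≠ x) (hr₂ : ∀ x, r (r x) ≠ x) (C : Finset V) (hC : ∀ x, r x ∈ C)
    (hcard : 3 * k * #C < Fintype.card V + 2 * #C) :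
    Unavoidable (functionalGraph r) (starGraph (none : Option (Fin (k + 1)))) := by
  classical
  refine unavoidable_starGraph C ?_
  have hfibers : Fintype.card V = ∑ v ∈ C, #{x | r x = v} :=
    Finset.card_eq_sum_card_fiberwise fun x _ => hC x
  have hdegrees : Fintype.card V + #C ≤ ∑ v ∈ C, (functionalGraph r).degree v := by
    rw [hfibers, Finset.card_eq_sum_ones, ← Finset.sum_add_distrib]
    exact Finset.sum_le_sum fun v _ => card_fiber_lt_degree_functionalGraph hr hr₂ v
  have hedges := card_edgeFinset_functionalGraph_le r
  omega

/-- A maximal independent set of vertices of degree at most one meets every edge. -/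
theorem IsStarForest.exists_leaves {W : Type*} [Finite W] {F : SimpleGraph W}
    (hF : IsStarForest F) : ∃ L : Set W, (∀ u ∈ L, (F.neighborSet u).Subsingleton) ∧
      ∀ u v, F.Adj u v → (u ∈ L ↔ v ∉ L) := by
  obtain ⟨L, hL⟩ := (Set.toFinite {L : Set W |
    (∀ u ∈ L, (F.neighborSet u).Subsingleton) ∧ F.IsIndepSet L}).exists_maximal
      ⟨∅, by simp⟩
  obtain ⟨hleaf, hindep⟩ := hL.prop
  have hcover : ∀ u v, F.Adj u v → (∀ w, F.Adj u w → w = v) → u ∈ L ∨ v ∈ L := by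
    intro u v huv hu
    by_contra! hnot
    refine hnot.1 (hL.le_of_ge (y := insert u L) ⟨?_, ?_⟩ (Set.subset_insert u L)
      (Set.mem_insert u L))
    · rintro x (rfl | hx)
      exacts [fun a ha b hb => (hu a ha).trans (hu b hb).symm, hleaf x hx]
    · refine hindep.insert fun w hw _ => ?_
      have : ¬ F.Adj u w := fun huw => hnot.2 (hu w huw ▸ hw)
      exact ⟨this, fun h => this h.symm⟩
  refine ⟨L, hleaf, fun u v huv => ⟨fun hu hv => hindep hu hv huv.ne huv, fun hv => ?_⟩⟩
  rcases hF u v huv with h | h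
  · exact (hcover u v huv h).resolve_right hv
  · exact (hcover v u huv.symm h).resolve_left hv

theorem IsStarForest.exists_eq_functionalGraph {W : Type*} [Finite W] {F : SimpleGraph W}
    (hF : IsStarForest F) : ∃ γ : W → W, (∀ w, γ (γ w) = γ w) ∧ F = functionalGraph γ := by
  classical
  obtain ⟨L, hleaf, hL⟩ := hF.exists_leaves
  let γ : W → W := fun w => if h : w ∈ L ∧ ∃ v, F.Adj w v then h.2.choose else w
  have hcenter : ∀ {w}, w ∉ L → γ w = w := fun hw => dif_neg fun h => hw h.1
  have hadj : ∀ w, γ w = w ∨ w ∈ L ∧ F.Adj w (γ w) := fun w => by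
    by_cases h : w ∈ L ∧ ∃ v, F.Adj w v
    · refine Or.inr ⟨h.1, ?_⟩
      simp only [γ, dif_pos h]
      exact h.2.choose_spec
    · exact Or.inl (dif_neg h)
  have hparent : ∀ {u v}, u ∈ L → F.Adj u v → γ u = v := fun {u v} hu huv => by
    have h : u ∈ L ∧ ∃ v, F.Adj u v := ⟨hu, v, huv⟩
    exact (dif_pos h).trans (hleaf u hu h.2.choose_spec huv)
  refine ⟨γ, fun w => ?_, ?_⟩
  · rcases hadj w with h | ⟨hw, h⟩
    · rw [h, h]
    · exact hcenter ((hL _ _ h).1 hw)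
  · ext u v
    rw [functionalGraph_adj]
    constructor
    · refine fun huv => ⟨huv.ne, ?_⟩
      by_cases hu : u ∈ L
      · exact Or.inl (hparent hu huv)
      · exact Or.inr (hparent ((hL _ _ huv.symm).2 hu) huv.symm)
    · rintro ⟨hne, rfl | rfl⟩
      · exact ((hadj u).resolve_left hne.symm).2
      · exact ((hadj v).resolve_left hne).2.symm

theorem functionalGraph_isContained_disjointCopies_starGraph {W : Type*} {γ : W → W} {k : ℕ}
    (hγ : ∀ w, γ (γ w) = γ w) (label : ∀ c, (functionalGraph γ).neighborSet c ↪ Fin k) :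
    functionalGraph γ ⊑ disjointCopies W (starGraph (none : Option (Fin k))) := by
  classical
  let φ : W → W × Option (Fin k) := fun w =>
    (γ w, if h : (functionalGraph γ).Adj (γ w) w then some (label (γ w) ⟨w, h⟩) else none)
  have hcenter : ∀ {w}, γ w = w → φ w = (w, none) := fun {w} hw =>
    Prod.ext hw (dif_neg fun h => h.ne hw)
  have hleaf : ∀ {c w} (h : (functionalGraph γ).Adj c w), γ w = c →
      φ w = (c, some (label c ⟨w, h⟩)) := by
    rintro _ w h rfl
    exact Prod.ext rfl (dif_pos h)
  have hparent : ∀ {w}, γ w ≠ w → (functionalGraph γ).Adj (γ w) w := fun hw =>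
    functionalGraph_adj.2 ⟨hw, Or.inr rfl⟩
  have hinj : Function.Injective φ := by
    intro u v huv
    have hγuv : γ u = γ v := congrArg Prod.fst huv
    by_cases hu : γ u = u <;> by_cases hv : γ v = v
    · rw [← hu, hγuv, hv]
    · rw [hcenter hu, hleaf (hparent hv) rfl] at huv
      simp at huv
    · rw [hcenter hv, hleaf (hparent hu) rfl] at huv
      simp at huv
    · rw [hleaf (hparent hv) rfl, hleaf (hγuv ▸ hparent hu) hγuv] at huv
      exact congrArg Subtype.val ((label _).injective (Option.some.inj (congrArg Prod.snd huv)))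
  have hedge : ∀ {u v}, u ≠ v → γ u = v →
      (disjointCopies W (starGraph none)).Adj (φ u) (φ v) := by
    rintro u _ hne rfl
    rw [hcenter (hγ u), hleaf (hparent hne.symm) rfl]
    exact ⟨rfl, by simp [starGraph_adj]⟩
  refine ⟨⟨⟨φ, fun {u v} huv => ?_⟩, hinj⟩⟩
  obtain ⟨hne, h | h⟩ := functionalGraph_adj.1 huv
  · exact hedge hne h
  · exact (hedge hne.symm h).symm

theorem IsStarForest.isContained_disjointCopies_starGraph {W : Type*} [Fintype W]
    {F : SimpleGraph W} [DecidableRel F.Adj] (hF : IsStarForest F) {k : ℕ}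
    (hk : ∀ v, F.degree v ≤ k) :
    F ⊑ disjointCopies W (starGraph (none : Option (Fin k))) := by
  obtain ⟨γ, hγ, rfl⟩ := hF.exists_eq_functionalGraph
  refine functionalGraph_isContained_disjointCopies_starGraph hγ fun c => Nonempty.some ?_
  refine Function.Embedding.nonempty_of_card_le ?_
  rw [card_neighborSet_eq_degree, Fintype.card_fin]
  exact hk c

theorem IsStarForest.exists_unavoidable_disjointCopies {V W : Type*} [Fintype W]
    {F : SimpleGraph W} [DecidableRel F.Adj] (hF : IsStarForest F) {k : ℕ}
    (hk : ∀ v, F.degree v ≤ k) {G : SimpleGraph V}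
    (hG : Unavoidable G (starGraph (none : Option (Fin k)))) :
    ∃ M, Unavoidable (disjointCopies (Fin M) G) F := by
  have hcopies := hG.disjointCopies (m := Fintype.card W) (Fintype.card_fin _).ge
  refine ⟨_, hcopies.anti_right ((hF.isContained_disjointCopies_starGraph hk).trans ⟨?_⟩)⟩
  exact assembleCopies (fun _ => Copy.id _) (Fintype.equivFin W).toEmbedding

/-! ### Suns -/

/-- The vertices of a cycle of length `l + 3` with `s` triples of pendant vertices at every vertex
of the cycle, and one extra pendant vertex attached to the vertex `0` of the cycle. -/
inductive SunVertex (s l : ℕ) : Type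
  | cycle (i : Fin (l + 3))
  | pendant (i : Fin (l + 3)) (a : Fin s) (t : Fin 3)
  | extra

namespace SunVertex

/-- The encoding of `SunVertex s l` by a type whose cardinality is evident. -/
def equivSum (s l : ℕ) :
    SunVertex s l ≃ Fin (l + 3) ⊕ (Fin (l + 3) × Fin s × Fin 3) ⊕ Unit where
  toFun
    | cycle i => Sum.inl i
    | pendant i a t => Sum.inr (Sum.inl (i, a, t))
    | extra => Sum.inr (Sum.inr ())
  invFun
    | Sum.inl i => cycle i
    | Sum.inr (Sum.inl (i, a, t)) => pendant i a t
    | Sum.inr (Sum.inr ()) => extra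
  left_inv x := by cases x <;> rfl
  right_inv x := by rcases x with _ | _ | _ <;> rfl

instance (s l : ℕ) : Fintype (SunVertex s l) := Fintype.ofEquiv _ (equivSum s l).symm

theorem card (s l : ℕ) : Fintype.card (SunVertex s l) = (l + 3) * (3 * s + 1) + 1 := by
  rw [Fintype.card_congr (equivSum s l)]
  simp only [Fintype.card_sum, Fintype.card_prod, Fintype.card_fin, Fintype.card_unit]
  ring

/-- The successor on the cycle, and the point of attachment of a pendant vertex. -/
def parent {s l : ℕ} : SunVertex s l → SunVertex s l
  | cycle i => cycle (i + 1)
  | pendant i _ _ => cycle i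
  | extra => cycle 0

theorem parent_ne {s l : ℕ} (x : SunVertex s l) : parent x ≠ x := by
  cases x <;> simp [parent]

theorem parent_parent_ne {s l : ℕ} (x : SunVertex s l) : parent (parent x) ≠ x := by
  cases x with
  | cycle i =>
    simp only [parent, add_assoc, ne_eq, cycle.injEq, add_eq_left, Fin.ext_iff, Fin.val_add]
    simp [Nat.mod_eq_of_lt]
  | pendant => simp [parent]
  | extra => simp [parent]

/-- Edges of a sun are labelled by their lower end, as in `parentEdge`. The labels are shifted away
from the vertex `j` of the cycle, and the three edges of every triple are permuted cyclically. For
`i = 0` the subtraction wraps around to the last vertex of the cycle. -/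
def step {s l : ℕ} (j : Fin (l + 3)) : SunVertex s l → SunVertex s l
  | cycle i =>
    if i = Fin.last (l + 2) then extra else if i < j then cycle (i - 1) else cycle (i + 1)
  | pendant i a t => pendant i a (t + 1)
  | extra => cycle 0

theorem step_cycle_eq_or {s l : ℕ} {i j : Fin (l + 3)} (hij : i + 1 ≠ j) :
    step j (cycle i : SunVertex s l) = cycle (i + 1) ∨
      step j (cycle (i + 1) : SunVertex s l) = cycle i := by
  rcases lt_or_gt_of_ne hij with h | h
  · right
    rw [step, if_neg (h.trans_le (Fin.le_last j)).ne, if_pos h, add_sub_cancel_right]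
  · left
    have hlast : i ≠ Fin.last (l + 2) := by
      rintro rfl
      simp at h
    have hji : ¬ i < j := by
      rw [Fin.lt_def, Fin.val_add_one, if_neg hlast] at h
      rw [Fin.lt_def]
      omega
    rw [step, if_neg hlast, if_neg hji]

theorem step_cycle_eq_extra_or {s l : ℕ} {i j : Fin (l + 3)} (hi : 0 = i ∨ 0 = i + 1) :
    step j (cycle i : SunVertex s l) = extra ∨ step j (extra : SunVertex s l) = cycle i := by
  rcases hi with rfl | hi
  · exact .inr rfl
  · obtain rfl : i = Fin.last (l + 2) :=
      add_right_cancel (hi.symm.trans (Fin.last_add_one _).symm)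
    exact .inl (if_pos rfl)

/-- The triple of pendant edges, among those at the same vertex of the cycle, that a label belongs
to; `none` for the edges that belong to no triple. -/
def triple {s l : ℕ} : SunVertex s l → Option (Fin s)
  | pendant _ a _ => some a
  | _ => none

theorem step_eq_or {s l : ℕ} {j : Fin (l + 3)} {c x y : SunVertex s l} (hc : c ≠ cycle j)
    (hx : c ∈ parentEdge parent x) (hy : c ∈ parentEdge parent y) (hxy : x ≠ y)
    (htriple : triple x = triple y) : step j x = y ∨ step j y = x := by
  rw [Sym2.mem_iff] at hx hy
  have hextra {i : Fin (l + 3)} (hi : c = cycle i ∨ c = cycle (i + 1))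
      (h : c = extra ∨ c = cycle 0) : 0 = i ∨ 0 = i + 1 := by
    rcases h with rfl | rfl
    · simp at hi
    · simpa only [cycle.injEq] using hi
  rcases x with i | ⟨i, a, t⟩ | _ <;> rcases y with i' | ⟨i', a', t'⟩ | _ <;>
    simp only [triple, parent, reduceCtorEq, Option.some.injEq] at htriple hx hy
  · rcases hx with rfl | rfl <;> rcases hy with hy | hy
    · exact absurd hy hxy
    · obtain rfl : i = i' + 1 := cycle.inj hy
      exact (step_cycle_eq_or fun h => hc (h ▸ rfl)).symm
    · obtain rfl : i + 1 = i' := cycle.inj hy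
      exact step_cycle_eq_or fun h => hc (h ▸ rfl)
    · exact absurd (congrArg cycle (add_right_cancel (cycle.inj hy))) hxy
  · exact step_cycle_eq_extra_or (hextra hx hy)
  · have hrotate : ∀ t t' : Fin 3, t ≠ t' → t + 1 = t' ∨ t' + 1 = t := by decide
    obtain rfl : i = i' := by grind
    obtain rfl : a = a' := htriple
    simpa only [step, pendant.injEq, true_and] using hrotate t t' fun h => hxy (h ▸ rfl)
  · exact (step_cycle_eq_extra_or (hextra hy hx)).symm
  · exact absurd rfl hxy

end SunVertex

open SunVertex

/-- The sun: a cycle with `3 * s` pendant edges at every vertex, and one extra pendant edge. -/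
abbrev sunGraph (s l : ℕ) : SimpleGraph (SunVertex s l) :=
  functionalGraph parent

theorem unavoidable_sunGraph (s l : ℕ) :
    Unavoidable (sunGraph s l) (starGraph (none : Option (Fin (s + 2)))) := by
  classical
  refine unavoidable_functionalGraph_starGraph parent_ne parent_parent_ne
    (Finset.univ.image cycle) (fun x => ?_) ?_
  · cases x <;> simp [parent]
  · rw [Finset.card_image_of_injective _ fun _ _ => cycle.inj, Finset.card_univ, Fintype.card_fin,
      SunVertex.card]
    nlinarith

theorem not_unavoidable_of_le_sunGraph {s l : ℕ} {H : SimpleGraph (SunVertex s l)}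
    (hH : H ≤ sunGraph s l) {j : Fin (l + 3)} (hj : cycle j ∉ H.support) :
    ¬ Unavoidable H (starGraph (none : Option (Fin (s + 2)))) := by
  intro h
  obtain ⟨φ, hφ⟩ := h.exists_free_copy
    (Function.extend (parentEdge parent) (fun x => parentEdge parent (step j x)) id)
  let edge : Fin (s + 2) → Sym2 (SunVertex s l) := fun i => s(φ none, φ (some i))
  have hadj : ∀ i : Fin (s + 2), (starGraph none).Adj none (some i) := fun i => by
    simp [starGraph_adj]
  have hedge : ∀ i, edge i ∈ Sym2.map φ '' (starGraph none).edgeSet := fun i =>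
    Set.mem_image_of_mem _ ((mem_edgeSet _).2 (hadj i))
  choose x hx using fun i =>
    edgeSet_functionalGraph_subset parent (edgeSet_mono hH (image_edgeSet_subset φ (hedge i)))
  have hedge_inj : Function.Injective edge := fun i i' hi =>
    Option.some.inj (φ.injective (Sym2.congr_right.1 hi))
  have hmem : ∀ i, φ none ∈ parentEdge parent (x i) := fun i =>
    hx i ▸ Sym2.mem_mk_left _ _
  have hcenter : φ none ≠ cycle j := fun hcj =>
    hj (hcj ▸ ⟨_, φ.toHom.map_adj (hadj 0)⟩)
  obtain ⟨i, i', hne, htriple⟩ := Fintype.exists_ne_map_eq_of_card_lt (fun i => triple (x i))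
    (by simp)
  have hfree : ∀ {i i'}, i ≠ i' → step j (x i) ≠ x i' := by
    intro i i' hne hstep
    refine hφ (hedge i) (hedge i') (hedge_inj.ne hne) ?_
    rw [← hx i, ← hx i', (parentEdge_injective parent_parent_ne).extend_apply, hstep]
  have hxne : x i ≠ x i' := fun h => hne (hedge_inj (by rw [← hx i, ← hx i', h]))
  rcases step_eq_or hcenter (hmem i) (hmem i') hxne htriple with h | h
  · exact hfree hne h
  · exact hfree hne.symm h

theorem not_unavoidable_of_isContained_disjointCopies_sunGraph {ι U : Type*} [Fintype U]
    {K : SimpleGraph U} {s l : ℕ} (hU : Fintype.card U < l + 3)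
    (hK : K ⊑ disjointCopies ι (sunGraph s l)) :
    ¬ Unavoidable K (starGraph (none : Option (Fin (s + 2)))) := by
  obtain ⟨ψ⟩ := hK
  let f : U ↪ ι × SunVertex s l := ⟨ψ, ψ.injective⟩
  have hle : K.map f ≤ disjointCopies ι (sunGraph s l) := by
    rintro _ _ ⟨-, u, v, huv, rfl, rfl⟩
    exact ψ.toHom.map_adj huv
  refine fun h => not_unavoidable_of_forall_comap (connected_starGraph _)
    (fun x y hxy => (hle hxy).1) (fun c => ?_) (h.mono (Embedding.map f K).isContained)
  obtain ⟨j, hj⟩ : ∃ j, (c, cycle j) ∉ Set.range f := by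
    by_contra! hall
    choose u hu using hall
    have hinj : Function.Injective u := fun i i' hi => by
      have := (hu i).symm.trans ((congrArg f hi).trans (hu i'))
      simpa using this
    have := Fintype.card_le_of_injective u hinj
    rw [Fintype.card_fin] at this
    omega
  refine not_unavoidable_of_le_sunGraph (j := j) (fun x y hxy => (hle hxy).2) ?_
  rintro ⟨y, -, u, v, -, hu, -⟩
  exact hj ⟨u, hu⟩

theorem IsStarForest.infinite_minimalUnavoidableGraphs {W : Type*} [Finite W]
    {F : SimpleGraph W} (hF : IsStarForest F) {v : W} (hv : ¬ (F.neighborSet v).Subsingleton) :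
    (minimalUnavoidableGraphs F).Infinite := by
  classical
  have := Fintype.ofFinite W
  have : Nonempty W := ⟨v⟩
  obtain ⟨v₀, hv₀⟩ := F.exists_maximal_degree_vertex
  have htwo : 2 ≤ F.maxDegree := by
    refine le_trans ?_ (F.degree_le_maxDegree v)
    rw [← card_neighborFinset_eq_degree]
    obtain ⟨a, ha, b, hb, hab⟩ := Set.not_subsingleton_iff.1 hv
    exact Finset.one_lt_card.2 ⟨a, by simpa using ha, b, by simpa using hb, hab⟩
  obtain ⟨s, hs⟩ := Nat.exists_eq_add_of_le' htwo
  obtain ⟨φ, -⟩ := exists_copy_starGraph (G := F) (v := v₀) (B := F.incidenceFinset v₀) (k := s + 2)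
    (by simp) (by rw [card_incidenceFinset_eq_degree, ← hv₀, hs])
  refine EdgeMapping.infinite_minimalUnavoidableGraphs fun N => ?_
  obtain ⟨M, hM⟩ := hF.exists_unavoidable_disjointCopies
    (fun u => (F.degree_le_maxDegree u).trans hs.le) (unavoidable_sunGraph s N)
  refine ⟨_, inferInstance, _, hM, fun n hn K hK hKF => ?_⟩
  refine not_unavoidable_of_isContained_disjointCopies_sunGraph ?_ hK (hKF.anti_right ⟨φ⟩)
  rw [Fintype.card_fin]
  omega

/-! ### Characterization of matchings -/

theorem eq_of_mem_edgeSet_of_existsUnique_adj {V : Type*} {G : SimpleGraph V} {v : V}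
    (hv : ∃! w, G.Adj v w) {e e' : Sym2 V} (he : e ∈ G.edgeSet) (he' : e' ∈ G.edgeSet)
    (hve : v ∈ e) (hve' : v ∈ e') : e = e' := by
  obtain ⟨w, rfl⟩ := hve
  obtain ⟨w', rfl⟩ := hve'
  exact Sym2.congr_right.2 (hv.unique he he')

theorem exists_iso_matchingGraph {V : Type*} [Finite V] {G : SimpleGraph V}
    (h : ∀ v, ∃! w, G.Adj v w) : ∃ t, Nonempty (G ≃g matchingGraph t) := by
  obtain ⟨t, ⟨ε⟩⟩ := Finite.exists_equiv_fin G.edgeSet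
  have hends (e : G.edgeSet) : ∃ a : Fin 2 → V, (e : Sym2 V) = s(a 0, a 1) :=
    ⟨![e.1.out.1, e.1.out.2], e.1.out_eq.symm⟩
  choose a ha using hends
  have hmem (e : G.edgeSet) (v : V) : v ∈ (e : Sym2 V) ↔ ∃ p, a e p = v := by
    rw [ha, Sym2.mem_iff, Fin.exists_fin_two, eq_comm, @eq_comm _ v]
  have hedge {e : G.edgeSet} {p : Fin 2} {e' : Sym2 V} (he' : e' ∈ G.edgeSet)
      (hpe' : a e p ∈ e') : (e : Sym2 V) = e' :=
    eq_of_mem_edgeSet_of_existsUnique_adj (h _) e.2 he' ((hmem e _).2 ⟨p, rfl⟩) hpe'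
  have hadj (e e' : G.edgeSet) (p p' : Fin 2) :
      G.Adj (a e p) (a e' p') ↔ e = e' ∧ p ≠ p' := by
    refine ⟨fun hadj => ?_, ?_⟩
    · obtain rfl : e = e' := Subtype.ext ((hedge hadj (Sym2.mem_mk_left _ _)).trans
        (hedge hadj (Sym2.mem_mk_right _ _)).symm)
      exact ⟨rfl, fun hp => hadj.ne (congrArg (a e) hp)⟩
    · rintro ⟨rfl, hp⟩
      have h01 : G.Adj (a e 0) (a e 1) := by
        rw [← mem_edgeSet, ← ha]
        exact e.2
      obtain ⟨rfl, rfl⟩ | ⟨rfl, rfl⟩ : p = 0 ∧ p' = 1 ∨ p = 1 ∧ p' = 0 := by omega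
      · exact h01
      · exact h01.symm
  have hbij : Function.Bijective fun x : G.edgeSet × Fin 2 => a x.1 x.2 := by
    refine ⟨fun ⟨e, p⟩ ⟨e', p'⟩ heq => ?_, fun v => ?_⟩
    · obtain rfl : e = e' := Subtype.ext (hedge e'.2 ((hmem e' _).2 ⟨p', heq.symm⟩))
      by_contra hne
      exact ((hadj e e p p').2 ⟨rfl, fun hp => hne (Prod.ext rfl hp)⟩).ne heq
    · obtain ⟨w, hvw, -⟩ := h v
      obtain ⟨p, hp⟩ := (hmem ⟨s(v, w), hvw⟩ v).1 (Sym2.mem_mk_left v w)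
      exact ⟨(_, p), hp⟩
  let i : matchingGraph t ≃g G :=
    { (ε.symm.prodCongr (Equiv.refl _)).trans (Equiv.ofBijective _ hbij) with
      map_rel_iff' := (hadj _ _ _ _).trans (and_congr_left' ε.symm.injective.eq_iff) }
  exact ⟨t, ⟨i.symm⟩⟩

theorem exists_iso_matchingGraph_iff {V : Type*} [Finite V] {G : SimpleGraph V} :
    (∃ t, Nonempty (G ≃g matchingGraph t)) ↔ ∀ v, ∃! w, G.Adj v w := by
  refine ⟨fun ⟨t, ⟨i⟩⟩ v => ?_, exists_iso_matchingGraph⟩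
  have hne : ∀ p q : Fin 2, p ≠ q ↔ q = 1 - p := by decide
  have hadj (w : V) : G.Adj v w ↔ i w = ((i v).1, 1 - (i v).2) := by
    rw [← i.map_adj_iff, Prod.ext_iff]
    exact and_congr eq_comm (hne _ _)
  simp only [hadj]
  exact i.bijective.existsUnique _

theorem existsUnique_adj_induce_support_iff {V : Type*} {G : SimpleGraph V} :
    (∀ v, ∃! w, (G.induce G.support).Adj v w) ↔ ∀ v, (G.neighborSet v).Subsingleton := by
  refine ⟨fun h v a ha b hb => ?_, fun h ⟨v, w, hvw⟩ => ?_⟩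
  · exact congrArg Subtype.val ((h ⟨v, a, ha⟩).unique (y₁ := ⟨a, v, ha.symm⟩)
      (y₂ := ⟨b, v, hb.symm⟩) ha hb)
  · exact ⟨⟨w, v, hvw.symm⟩, hvw, fun w' hw' => Subtype.ext (h v hw' hvw)⟩

theorem finite_minimalUnavoidableGraphs_iff {W : Type*} [Finite W] {F : SimpleGraph W}
    (hF : F.IsAcyclic) :
    (minimalUnavoidableGraphs F).Finite ↔ ∀ v, (F.neighborSet v).Subsingleton := by
  refine ⟨fun hfin => ?_, fun h => ?_⟩
  · by_contra! hdegree
    obtain ⟨v, hv⟩ := hdegree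
    by_cases hstar : IsStarForest F
    · exact hstar.infinite_minimalUnavoidableGraphs (Set.not_subsingleton_iff.2 hv) hfin
    · exact infinite_minimalUnavoidableGraphs_of_not_isStarForest hF hstar hfin
  · obtain ⟨t, ⟨i⟩⟩ := exists_iso_matchingGraph (existsUnique_adj_induce_support_iff.2 h)
    exact finite_minimalUnavoidableGraphs i

end EdgeMapping

theorem mainTheorem2 {V : Type*} [Finite V] (F : SimpleGraph V) (hF : F.IsAcyclic) :
    -- for forests without isolated vertices: `𝓜(F)` is finite iff `F = t K₂`
    ((∀ v, ∃ w, F.Adj v w) →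
      ((EdgeMapping.minimalUnavoidableGraphs F).Finite ↔
        ∃ t : ℕ, Nonempty (F ≃g EdgeMapping.matchingGraph t))) ∧
    -- for all forests: `𝓜(F)` is finite iff `F`, with its isolated vertices removed, is `t K₂`
    ((EdgeMapping.minimalUnavoidableGraphs F).Finite ↔
      ∃ t : ℕ, Nonempty (F.induce F.support ≃g EdgeMapping.matchingGraph t)) := by
  rw [EdgeMapping.finite_minimalUnavoidableGraphs_iff hF,
    EdgeMapping.exists_iso_matchingGraph_iff, EdgeMapping.exists_iso_matchingGraph_iff,
    EdgeMapping.existsUnique_adj_induce_support_iff]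
  refine ⟨fun hisolated => forall_congr' fun v => ?_, Iff.rfl⟩
  refine ⟨fun h => ?_, fun h a ha b hb => h.unique ha hb⟩
  obtain ⟨w, hw⟩ := hisolated v
  exact ⟨w, hw, fun w' hw' => h hw' hw⟩
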